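/- **Theorem 2.2.** Let $\mathcal{A}$ be a complex unital Banach algebra. An element $x\in\mathcal A$ is *generalized Drazin invertible*, $x\in\mathcal{A}^d$, if there is a (then unique) element $x^d\in\mathcal A$ with $x^d x x^d=x^d$, $xx^d=x^dx$ and $x-x^2x^d$ quasinilpotent (i.e. of spectral radius $0$); in that case $x^\pi:=1-xx^d$. Let $a,b\in\mathcal{A}^d$ satisfy $aba^\pi=a^\pi b^\pi bab^\pi a^\pi$ and $a^2a^db=aa^dba$, and suppose that at least one of the elements $a^\pi ba^\pi$, $a^\pi b$, $ba^\pi$, $aa^dbaa^d$, $aa^db$, $baa^d$ is generalized Drazin invertible. Then $$a+b\in\mathcal{A}^d \iff 1+a^db\in\mathcal{A}^d \iff aa^d(1+a^db)\in\mathcal{A}^d \iff (1+a^db)aa^d\in\mathcal{A}^d \iff aa^d(1+a^db)aa^d\in\mathcal{A}^d.$$ In this case, put $c=aa^d(a+b)$. Then $c\in\mathcal{A}^d$, $$c^d=a^d(1+a^db)^d\,bb^d+\sum_{n=0}^{\infty}aa^d\,b^\pi(-b)^n(a^d)^{n+1},$$ and $$\begin{aligned}(a+b)^d={}&c^d+\sum_{n=0}^{\infty}(b^d)^{n+1}a^na^\pi-\sum_{n=0}^{\infty}(b^d)^{n+1}a^na^\pi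 b\,c^d+\sum_{n=0}^{\infty}\sum_{k=0}^{\infty}(b^d)^{n+k+2}a^ka^\pi b\,aa^d\,c^nc^\pi\\&+\sum_{n=0}^{\infty}b^\pi(a+b)^na^\pi b\,(c^d)^{n+2}-\sum_{n=0}^{\infty}\sum_{k=0}^{\infty}(b^d)^{k+1}a^{k+1}(a+b)^na^\pi b\,(c^d)^{n+2},\end{aligned}$$ where all the series converge unconditionally (in the double series the inner series, over $k$, converges for each $n$, and so does the outer series over $n$ of the inner sums). -/

import Mathlib

/-- An element of a complex Banach algebra is quasinilpotent if its spectral radius is zero. -/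
def IsQuasinilpotent {A : Type*} [NormedRing A] [NormedAlgebra ℂ A] (a : A) : Prop :=
  spectralRadius ℂ a = 0

/-- `x` is a generalized Drazin (Koliha-Drazin) inverse of `a`. -/
structure IsGDrazinInverse {A : Type*} [NormedRing A] [NormedAlgebra ℂ A] (a x : A) : Prop where
  outer : x * a * x = x
  comm : a * x = x * a
  quasinilpotent : IsQuasinilpotent (a - a ^ 2 * x)

/-- `a` belongs to the set of generalized Drazin invertible elements. -/
def IsGDrazinInvertible {A : Type*} [NormedRing A] [NormedAlgebra ℂ A] (a : A) : Prop :=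
  ∃ x : A, IsGDrazinInverse a x

open Classical in
/-- The generalized Drazin inverse of `a` (with the value `0` if `a` is not generalized Drazin
invertible). Uniqueness is `IsGDrazinInverse.eq_gDrazinInv` below. -/
noncomputable def gDrazinInv {A : Type*} [NormedRing A] [NormedAlgebra ℂ A] (a : A) : A :=
  if h : IsGDrazinInvertible a then h.choose else 0

/-- `aᵈ` is the generalized Drazin inverse of `a`. -/
postfix:max "ᵈ" => gDrazinInv

/-- The spectral idempotent `1 - a aᵈ` of `a` corresponding to `{0}`. -/
noncomputable def spectralIdem {A : Type*} [NormedRing A] [NormedAlgebra ℂ A] (a : A) : A :=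
  1 - a * aᵈ

/-- `aᵖ` is the spectral idempotent of `a`. -/
postfix:max "ᵖ" => spectralIdem

theorem IsGDrazinInvertible.isGDrazinInverse {A : Type*} [NormedRing A] [NormedAlgebra ℂ A]
    {a : A} (h : IsGDrazinInvertible a) : IsGDrazinInverse a aᵈ := by
  unfold gDrazinInv
  rw [dif_pos h]
  exact h.choose_spec

/-- Powers of a quasinilpotent element beat every geometric sequence. -/
theorem IsQuasinilpotent.tendsto {A : Type*} [NormedRing A] [NormedAlgebra ℂ A] [CompleteSpace A]
    {q : A} (h : IsQuasinilpotent q) {r : ℝ} (hr : 0 ≤ r) :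
    Filter.Tendsto (fun n : ℕ => r ^ n * ‖q ^ n‖) Filter.atTop (nhds 0) := by
  have h1 := spectrum.pow_norm_pow_one_div_tendsto_nhds_spectralRadius q
  rw [show spectralRadius ℂ q = 0 from h] at h1
  set ε : ℝ := (2 * (r + 1))⁻¹ with hε
  have hεpos : 0 < ε := by positivity
  have h2 := h1.eventually (gt_mem_nhds (ENNReal.ofReal_pos.2 hεpos))
  refine squeeze_zero' (g := fun n : ℕ => ((1 : ℝ) / 2) ^ n)
    (Filter.Eventually.of_forall fun n => by positivity) ?_
    (tendsto_pow_atTop_nhds_zero_of_lt_one (by norm_num) (by norm_num))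
  filter_upwards [h2, Filter.eventually_gt_atTop 0] with n hn hn0
  have h3 : ‖q ^ n‖ ^ (1 / n : ℝ) < ε := (ENNReal.ofReal_lt_ofReal_iff hεpos).1 hn
  have h4 : ‖q ^ n‖ ≤ ε ^ n := by
    have h5 : (‖q ^ n‖ ^ (1 / n : ℝ)) ^ n = ‖q ^ n‖ := by
      rw [one_div]
      exact Real.rpow_inv_natCast_pow (norm_nonneg _) hn0.ne'
    rw [← h5]
    exact pow_le_pow_left₀ (by positivity) h3.le n
  calc r ^ n * ‖q ^ n‖ ≤ r ^ n * ε ^ n := by gcongr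
    _ = (r * ε) ^ n := by rw [mul_pow]
    _ ≤ (1 / 2) ^ n := by
      refine pow_le_pow_left₀ (by positivity) ?_ n
      rw [hε, ← div_eq_mul_inv, div_le_div_iff₀ (by positivity) (by norm_num)]
      linarith

/-- The generalized Drazin inverse is unique. -/
theorem IsGDrazinInverse.unique {A : Type*} [NormedRing A] [NormedAlgebra ℂ A] [CompleteSpace A]
    {a x y : A} (hx : IsGDrazinInverse a x) (hy : IsGDrazinInverse a y) : x = y := by
  have key : ∀ {u v : A}, IsGDrazinInverse a u → IsGDrazinInverse a v →
      u * a * (1 - a * v) = 0 ∧ (1 - a * v) * (a * u) = 0 := by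
    intro u v hu hv
    have cu : Commute a u := hu.comm
    have cv : Commute a v := hv.comm
    have iu : IsIdempotentElem (u * a) := by
      unfold IsIdempotentElem
      rw [← mul_assoc, hu.outer]
    have iv : IsIdempotentElem (1 - a * v) := by
      refine IsIdempotentElem.one_sub ?_
      unfold IsIdempotentElem
      rw [mul_assoc, ← mul_assoc v, hv.outer]
    have ca : Commute a (1 - a * v) :=
      (Commute.one_right a).sub_right ((Commute.refl a).mul_right cv)
    have hq : a - a ^ 2 * v = a * (1 - a * v) := by rw [mul_sub, mul_one, pow_two, mul_assoc]
    have hlim := hv.quasinilpotent.tendsto (norm_nonneg u)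
    rw [hq] at hlim
    have pw : ∀ n : ℕ, 0 < n → (a * (1 - a * v)) ^ n = a ^ n * (1 - a * v) := by
      intro n hn
      rw [ca.mul_pow, iv.pow_eq hn.ne']
    have e1 : ∀ n : ℕ, 0 < n →
        u * a * (1 - a * v) = u ^ n * (a * (1 - a * v)) ^ n := by
      intro n hn
      rw [pw n hn, ← mul_assoc, ← cu.symm.mul_pow, iu.pow_eq hn.ne']
    have e2 : ∀ n : ℕ, 0 < n →
        (1 - a * v) * (a * u) = (a * (1 - a * v)) ^ n * u ^ n := by
      intro n hn
      rw [pw n hn, (ca.pow_left n).eq, mul_assoc, ← cu.mul_pow, cu.eq, iu.pow_eq hn.ne']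
    constructor
    · refine norm_le_zero_iff.1 (ge_of_tendsto hlim ?_)
      filter_upwards [Filter.eventually_gt_atTop 0] with n hn
      rw [e1 n hn]
      exact (norm_mul_le _ _).trans (by gcongr; exact norm_pow_le' _ hn)
    · refine norm_le_zero_iff.1 (ge_of_tendsto hlim ?_)
      filter_upwards [Filter.eventually_gt_atTop 0] with n hn
      rw [e2 n hn, mul_comm (‖u‖ ^ n)]
      exact (norm_mul_le _ _).trans (by gcongr; exact norm_pow_le' _ hn)
  have h1 : x * a = x * a * (a * y) := by
    have := (key hx hy).1
    rwa [mul_sub, mul_one, sub_eq_zero] at this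
  have h2 : a * y = a * x * (a * y) := by
    have := (key hy hx).2
    rwa [sub_mul, one_mul, sub_eq_zero] at this
  have h3 : a * x = a * y := by
    rw [hx.comm, h1, ← hx.comm, ← h2]
  calc x = x * (a * x) := by rw [← mul_assoc, hx.outer]
    _ = a * x * y := by rw [h3, ← mul_assoc, ← hx.comm, h3]
    _ = y := by rw [h3, hy.comm, hy.outer]

theorem IsGDrazinInverse.eq_gDrazinInv {A : Type*} [NormedRing A] [NormedAlgebra ℂ A]
    [CompleteSpace A] {a x : A} (h : IsGDrazinInverse a x) : aᵈ = x :=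
  IsGDrazinInverse.unique (IsGDrazinInvertible.isGDrazinInverse ⟨x, h⟩) h

/-! Put p = a aᵈ and r = 1 - p. Since a commutes with p b and a r is quasinilpotent, p b r = 0, so b
and a + b are lower triangular with respect to p. Generalized Drazin invertibility of one corner of
b then makes bᵈ triangular too (`corner_eq_zero_left`, `corner_eq_zero_right`), and the corners of
bᵈ invert those of b.

On the r-corner, the condition on a b aᵖ lets the quasinilpotent a r be added to b r:
`add_quasinilpotent` gives (a + b) r the inverse Y = Σ (bᵈ)^(n+1) aⁿ aᵖ with no further assumption.
Hence a + b is generalized Drazin invertible exactly when its other corner c = p (a + b) is. As c =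
(a² aᵈ)(1 + aᵈ b) with commuting factors, the first invertible in p A p, this is a question about 1
+ aᵈ b.

For the formula, `triangular` assembles (a + b)ᵈ from cᵈ and Y. It follows from the sum formula for
u v = 0 (`add_of_mul_eq_zero`) with u = s p, v = s (1 - p), after Cline's formula has moved the
inverse from p s to s p. `add_eq_series` expands Y into the stated series, and `mul_one_sub_eq_tsum`
computes cᵈ bᵖ.

The recurring device is that t = x t q or t = q t x with q quasinilpotent forces t = 0, since t = xⁿ
t qⁿ for every n. -/

/-! ### Quasinilpotent elements: growth of powers, sums and products. -/

section Quasinilpotent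

variable {A : Type*} [NormedRing A] [NormedAlgebra ℂ A]

theorem isQuasinilpotent_iff_forall_isUnit {q : A} :
    IsQuasinilpotent q ↔ ∀ z : ℂ, z ≠ 0 → IsUnit (algebraMap ℂ A z - q) := by
  unfold IsQuasinilpotent spectralRadius
  simp only [ENNReal.iSup_eq_zero, ENNReal.coe_eq_zero, nnnorm_eq_zero]
  refine forall_congr' fun z => ?_
  rw [spectrum.mem_iff]
  tauto

/-- A nonzero spectral value z would give ‖z‖ⁿ ≤ ‖qⁿ‖ ‖1‖, contradicting the decay at r = ‖z‖⁻¹.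
Together with `IsQuasinilpotent.tendsto` this turns quasinilpotency into a norm estimate. -/
theorem isQuasinilpotent_of_tendsto [CompleteSpace A] {q : A}
    (h : ∀ r : ℝ, 0 ≤ r →
      Filter.Tendsto (fun n : ℕ => r ^ n * ‖q ^ n‖) Filter.atTop (nhds 0)) :
    IsQuasinilpotent q := by
  rw [isQuasinilpotent_iff_forall_isUnit]
  intro z hz
  by_contra hu
  have hmem : z ∈ spectrum ℂ q := spectrum.mem_iff.2 hu
  have hlim := (h ‖z‖⁻¹ (by positivity)).mul_const ‖(1 : A)‖
  rw [zero_mul] at hlim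
  refine absurd (ge_of_tendsto' hlim (b := 1) fun n => ?_) (by norm_num)
  have h1 := spectrum.norm_le_norm_mul_of_mem (spectrum.pow_mem_pow q n hmem)
  rw [norm_pow] at h1
  have hz' : 0 < ‖z‖ ^ n := by positivity
  rw [inv_pow, mul_assoc, ← div_eq_inv_mul, le_div_iff₀ hz', one_mul]
  exact h1

/-- If `t = x t q` with `q` quasinilpotent, then `t = 0`. -/
theorem IsQuasinilpotent.eq_zero_of_eq_mul_mul [CompleteSpace A] {q t x : A}
    (hq : IsQuasinilpotent q) (h : t = x * t * q) : t = 0 := by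
  have hpow : ∀ n : ℕ, t = x ^ n * t * q ^ n := by
    intro n
    induction n with
    | zero => simp
    | succ n ih =>
      calc t = x ^ n * (x * t * q) * q ^ n := by rw [← h]; exact ih
        _ = x ^ (n + 1) * t * q ^ (n + 1) := by rw [pow_succ x, pow_succ' q]; simp only [mul_assoc]
  have hlim := (hq.tendsto (norm_nonneg x)).mul_const ‖t‖
  rw [zero_mul] at hlim
  refine norm_le_zero_iff.1 (ge_of_tendsto hlim ?_)
  -- The exponent 0 is excluded because ‖1‖ is not assumed to be at most 1.
  filter_upwards [Filter.eventually_gt_atTop 0] with n hn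
  calc ‖t‖ = ‖x ^ n * t * q ^ n‖ := by rw [← hpow n]
    _ ≤ ‖x ^ n‖ * ‖t‖ * ‖q ^ n‖ := norm_mul₃_le
    _ ≤ ‖x‖ ^ n * ‖t‖ * ‖q ^ n‖ := by gcongr; exact norm_pow_le' _ hn
    _ = _ := by ring

/-- If `t = q t x` with `q` quasinilpotent, then `t = 0`. -/
theorem IsQuasinilpotent.eq_zero_of_eq_mul_mul' [CompleteSpace A] {q t x : A}
    (hq : IsQuasinilpotent q) (h : t = q * t * x) : t = 0 := by
  have hpow : ∀ n : ℕ, t = q ^ n * t * x ^ n := by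
    intro n
    induction n with
    | zero => simp
    | succ n ih =>
      calc t = q ^ n * (q * t * x) * x ^ n := by rw [← h]; exact ih
        _ = q ^ (n + 1) * t * x ^ (n + 1) := by rw [pow_succ q, pow_succ' x]; simp only [mul_assoc]
  have hlim := (hq.tendsto (norm_nonneg x)).mul_const ‖t‖
  rw [zero_mul] at hlim
  refine norm_le_zero_iff.1 (ge_of_tendsto hlim ?_)
  filter_upwards [Filter.eventually_gt_atTop 0] with n hn
  calc ‖t‖ = ‖q ^ n * t * x ^ n‖ := by rw [← hpow n]
    _ ≤ ‖q ^ n‖ * ‖t‖ * ‖x ^ n‖ := norm_mul₃_le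
    _ ≤ ‖q ^ n‖ * ‖t‖ * ‖x‖ ^ n := by gcongr; exact norm_pow_le' _ hn
    _ = _ := by ring

theorem IsQuasinilpotent.mul_comm {x y : A} (h : IsQuasinilpotent (x * y)) :
    IsQuasinilpotent (y * x) := by
  rw [isQuasinilpotent_iff_forall_isUnit] at h ⊢
  intro z hz
  have h1 : z ∉ spectrum ℂ (x * y) \ {0} := fun h2 => h2.1 (h z hz)
  rw [spectrum.nonzero_mul_comm] at h1
  by_contra h2
  exact h1 ⟨h2, hz⟩

/-- The resolvent factors: z (z - u - v) = (z - u)(z - v) when u v = 0. -/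
theorem IsQuasinilpotent.add_of_mul_eq_zero {u v : A} (hu : IsQuasinilpotent u)
    (hv : IsQuasinilpotent v) (h : u * v = 0) : IsQuasinilpotent (u + v) := by
  rw [isQuasinilpotent_iff_forall_isUnit] at *
  intro z hz
  have h1 : IsUnit (algebraMap ℂ A z) := (IsUnit.mk0 z hz).map (algebraMap ℂ A)
  have h2 : algebraMap ℂ A z * (algebraMap ℂ A z - (u + v)) =
      (algebraMap ℂ A z - u) * (algebraMap ℂ A z - v) := by
    rw [mul_sub, mul_sub, sub_mul, sub_mul, h, ← Algebra.commutes z u, mul_add]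
    abel
  exact (h1.mul_left_iff).1 (h2 ▸ (hu z hz).mul (hv z hz))

theorem IsQuasinilpotent.mul_of_commute [CompleteSpace A] {q x : A} (hq : IsQuasinilpotent q)
    (h : Commute q x) : IsQuasinilpotent (q * x) := by
  refine isQuasinilpotent_of_tendsto fun r hr => ?_
  refine squeeze_zero' (.of_forall fun n => by positivity) ?_
    (hq.tendsto (r := r * ‖x‖) (by positivity))
  filter_upwards [Filter.eventually_gt_atTop 0] with n hn
  rw [h.mul_pow, mul_pow, mul_assoc]
  gcongr
  rw [_root_.mul_comm]
  exact (norm_mul_le _ _).trans (by gcongr; exact norm_pow_le' _ hn)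

/-- With w = z - u invertible, z - u - v = w (1 - w⁻¹ v), and w⁻¹ v is quasinilpotent because v
commutes with w⁻¹. -/
theorem IsQuasinilpotent.add_of_commute [CompleteSpace A] {u v : A} (hu : IsQuasinilpotent u)
    (hv : IsQuasinilpotent v) (h : Commute u v) : IsQuasinilpotent (u + v) := by
  have hu' := isQuasinilpotent_iff_forall_isUnit.1 hu
  rw [isQuasinilpotent_iff_forall_isUnit]
  intro z hz
  obtain ⟨w, hw⟩ := hu' z hz
  have hvw : Commute v (w⁻¹ : Aˣ) := by
    refine Commute.units_inv_right ?_
    rw [hw]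
    exact Commute.sub_right (Algebra.commutes z v).symm h.symm
  have h1 := isQuasinilpotent_iff_forall_isUnit.1 (hv.mul_of_commute hvw) 1 one_ne_zero
  rw [map_one, hvw.eq] at h1
  have h2 : algebraMap ℂ A z - (u + v) = w * (1 - (w⁻¹ : Aˣ) * v) := by
    rw [mul_sub, Units.mul_inv_cancel_left, hw]
    noncomm_ring
  rw [h2]
  exact w.isUnit.mul h1

theorem IsQuasinilpotent.zero : IsQuasinilpotent (0 : A) := spectrum.spectralRadius_zero

theorem isQuasinilpotent_of_mul_self_eq_zero [CompleteSpace A] {q : A} (h : q * q = 0) : IsQuasinilpotent q := by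
  refine isQuasinilpotent_of_tendsto fun r _ => tendsto_const_nhds.congr' ?_
  filter_upwards [Filter.eventually_ge_atTop 2] with n hn
  rw [show q ^ n = 0 from pow_eq_zero_of_le hn (by rw [pow_two, h]), norm_zero, mul_zero]

theorem IsQuasinilpotent.summable [CompleteSpace A] {q : A} (hq : IsQuasinilpotent q) {r : ℝ}
    (hr : 0 ≤ r) : Summable fun n : ℕ => r ^ n * ‖q ^ n‖ := by
  have h := (hq.tendsto (r := 2 * r) (by positivity)).eventually_le_const (zero_lt_one)
  refine Summable.of_norm_bounded_eventually_nat (g := fun n => (1 / 2 : ℝ) ^ n)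
    summable_geometric_two ?_
  filter_upwards [h] with n hn
  rw [Real.norm_of_nonneg (by positivity)]
  rw [mul_pow, mul_assoc] at hn
  rw [one_div, inv_pow, ← one_div, le_div_iff₀ (by positivity)]
  linarith

theorem IsQuasinilpotent.summable_pow_mul_mul_pow [CompleteSpace A] {q : A}
    (hq : IsQuasinilpotent q) (s x : A) : Summable fun n : ℕ => q ^ n * s * x ^ n := by
  refine Summable.of_norm_bounded_eventually_nat (g := fun n => ‖x‖ ^ n * ‖q ^ n‖ * ‖s‖)
    ((hq.summable (norm_nonneg x)).mul_right _) ?_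
  filter_upwards [Filter.eventually_gt_atTop 0] with n hn
  calc ‖q ^ n * s * x ^ n‖
     ≤ ‖q ^ n‖ * ‖s‖ * ‖x ^ n‖ := norm_mul₃_le
    _ ≤ ‖q ^ n‖ * ‖s‖ * ‖x‖ ^ n := by gcongr; exact norm_pow_le' _ hn
    _ = _ := by ring

theorem IsQuasinilpotent.summable_pow_mul_mul_pow' [CompleteSpace A] {q : A}
    (hq : IsQuasinilpotent q) (s x : A) : Summable fun n : ℕ => x ^ n * s * q ^ n := by
  refine Summable.of_norm_bounded_eventually_nat (g := fun n => ‖x‖ ^ n * ‖q ^ n‖ * ‖s‖)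
    ((hq.summable (norm_nonneg x)).mul_right _) ?_
  filter_upwards [Filter.eventually_gt_atTop 0] with n hn
  calc ‖x ^ n * s * q ^ n‖
     ≤ ‖x ^ n‖ * ‖s‖ * ‖q ^ n‖ := norm_mul₃_le
    _ ≤ ‖x‖ ^ n * ‖s‖ * ‖q ^ n‖ := by gcongr; exact norm_pow_le' _ hn
    _ = _ := by ring

end Quasinilpotent

/-! ### Calculus of generalized Drazin inverses: commutation, products, Cline's formula. -/

section GDrazin

variable {A : Type*} [NormedRing A] [NormedAlgebra ℂ A]

namespace IsGDrazinInverse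

variable {a x : A}

theorem isQuasinilpotent_mul_one_sub (h : IsGDrazinInverse a x) :
    IsQuasinilpotent (a * (1 - a * x)) := by
  convert h.quasinilpotent using 1
  noncomm_ring

theorem isQuasinilpotent_one_sub_mul (h : IsGDrazinInverse a x) :
    IsQuasinilpotent ((1 - a * x) * a) := by
  convert h.quasinilpotent using 1
  linear_combination (norm := noncomm_ring) a * h.comm

theorem mul_mul_self (h : IsGDrazinInverse a x) : x * x * a = x := by
  linear_combination (norm := noncomm_ring) h.outer - x * h.comm

theorem self_mul_mul (h : IsGDrazinInverse a x) : a * x * x = x := by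
  linear_combination (norm := noncomm_ring) h.outer + h.comm * x

theorem mul_one_sub (h : IsGDrazinInverse a x) : a * (1 - a * x) = (1 - a * x) * a := by
  linear_combination (norm := noncomm_ring) - a * h.comm

theorem mul_one_sub_comm (h : IsGDrazinInverse a x) : Commute a (1 - a * x) := h.mul_one_sub

theorem one_sub_mul_one_sub (h : IsGDrazinInverse a x) :
    (1 - a * x) * (1 - a * x) = 1 - a * x := by
  linear_combination (norm := noncomm_ring) a * h.outer

theorem one_sub_mul_mul_one_sub (h : IsGDrazinInverse a x) :
    (1 - a * x) * a * (1 - a * x) = a * (1 - a * x) := by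
  linear_combination (norm := noncomm_ring)
    a * h.one_sub_mul_one_sub - h.mul_one_sub * (1 - a * x)

/-- The generalized Drazin inverse of `a` commutes with everything that commutes with `a`. -/
theorem commute [CompleteSpace A] (h : IsGDrazinInverse a x) {y : A} (hy : Commute a y) :
    Commute x y := by
  have hy : a * y = y * a := hy
  -- Both off-diagonal corners of y with respect to the idempotent a x vanish: a is invertible on
  -- one side of each and quasinilpotent on the other.
  have h1 : a * x * y * (1 - a * x) = 0 := by
    refine h.isQuasinilpotent_mul_one_sub.eq_zero_of_eq_mul_mul (x := x) ?_
    have hQ : (1 - a * x) * (a * (1 - a * x)) = a * (1 - a * x) := by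
      linear_combination (norm := noncomm_ring)
        a * h.comm - a * h.comm * a * x + a * a * h.outer
    have h2 : x * (a * x) * a = a * x := by
      linear_combination (norm := noncomm_ring) h.outer * a - h.comm
    calc a * x * y * (1 - a * x) = x * (a * x) * (a * y) * (1 - a * x) := by
          rw [← mul_assoc, h2]
      _ = x * (a * x * y) * (a * (1 - a * x)) := by rw [hy]; simp only [mul_assoc]
      _ = x * (a * x * y) * ((1 - a * x) * (a * (1 - a * x))) := by rw [hQ]
      _ = _ := by simp only [mul_assoc]
  have h2 : (1 - a * x) * y * (a * x) = 0 := by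
    refine h.isQuasinilpotent_mul_one_sub.eq_zero_of_eq_mul_mul' (x := x) ?_
    have hQ : (a * (1 - a * x)) * (1 - a * x) = (1 - a * x) * a := by
      linear_combination (norm := noncomm_ring) a * a * h.outer - a * h.comm
    have h2 : a * (a * x) * x = a * x := by
      linear_combination (norm := noncomm_ring) a * h.self_mul_mul
    symm
    calc a * (1 - a * x) * ((1 - a * x) * y * (a * x)) * x
        = (a * (1 - a * x)) * (1 - a * x) * y * (a * x) * x := by simp only [mul_assoc]
      _ = (1 - a * x) * (a * y) * (a * x) * x := by rw [hQ]; simp only [mul_assoc]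
      _ = (1 - a * x) * y * (a * (a * x) * x) := by rw [hy]; simp only [mul_assoc]
      _ = _ := by rw [h2]
  have h3 : a * x * y = y * (a * x) := by
    linear_combination (norm := noncomm_ring) h1 - h2
  show x * y = y * x
  calc x * y = x * (a * x * y) := by rw [← mul_assoc, ← mul_assoc, h.outer]
    _ = x * y * a * x := by rw [h3]; simp only [mul_assoc]
    _ = (x * a) * y * x := by rw [mul_assoc x, ← hy]; simp only [mul_assoc]
    _ = y * (a * x * x) := by rw [← h.comm, h3]; simp only [mul_assoc]
    _ = y * x := by rw [h.self_mul_mul]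

/-- The quasinilpotent part of a b is a(1 - a x) b + b(1 - b y) a² x, a sum of two commuting
quasinilpotents. -/
theorem mul [CompleteSpace A] {b y : A} (ha : IsGDrazinInverse a x) (hb : IsGDrazinInverse b y)
    (hab : Commute a b) : IsGDrazinInverse (a * b) (x * y) := by
  have hxb : Commute x b := ha.commute hab
  have hya : Commute y a := hb.commute hab.symm
  have hxy : Commute x y := ha.commute hya.symm
  have hax : Commute a x := ha.comm
  have hby : Commute b y := hb.comm
  have hxbe : x * b = b * x := hxb
  have e : a * b * (x * y) = (a * x) * (b * y) := by
    linear_combination (norm := noncomm_ring) - a * hxbe * y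
  refine ⟨?_, ?_, ?_⟩
  · calc x * y * (a * b) * (x * y) = x * (y * ((a * x) * (b * y))) := by
          rw [mul_assoc, e, mul_assoc]
      _ = (x * (a * x)) * (y * (b * y)) := by
          rw [← mul_assoc y, (hya.mul_right hxy.symm).eq]; simp only [mul_assoc]
      _ = x * y := by rw [← mul_assoc x a x, ← mul_assoc y b y, ha.outer, hb.outer]
  · exact ((hax.mul_right hya.symm).mul_left (hxb.symm.mul_right hby)).eq
  · have h1 : IsQuasinilpotent (a * (1 - a * x) * b) :=
      ha.isQuasinilpotent_mul_one_sub.mul_of_commute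
        (hab.mul_left ((Commute.one_left b).sub_left (hab.mul_left hxb)))
    have h2 : IsQuasinilpotent (b * (1 - b * y) * (a * (a * x))) := by
      refine hb.isQuasinilpotent_mul_one_sub.mul_of_commute ?_
      have c1 : Commute b (a * (a * x)) := hab.symm.mul_right (hab.symm.mul_right hxb.symm)
      have c2 : Commute y (a * (a * x)) := hya.mul_right (hya.mul_right hxy.symm)
      exact c1.mul_left ((Commute.one_left _).sub_left (c1.mul_left c2))
    have h12 : Commute (a * (1 - a * x) * b) (b * (1 - b * y) * (a * (a * x))) := by
      have c1 : Commute (a * (1 - a * x)) (a * (a * x)) := by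
        have : Commute a (a * (a * x)) :=
          (Commute.refl a).mul_right ((Commute.refl a).mul_right hax)
        have h3 : Commute x (a * (a * x)) :=
          hax.symm.mul_right (hax.symm.mul_right (.refl x))
        exact this.mul_left ((Commute.one_left _).sub_left (this.mul_left h3))
      have c2 : Commute b (b * (1 - b * y)) :=
        (Commute.refl b).mul_right ((Commute.one_right _).sub_right
          ((Commute.refl b).mul_right hby))
      have c3 : Commute (a * (1 - a * x)) (b * (1 - b * y)) := by
        have c4 : Commute a (b * (1 - b * y)) :=
          hab.mul_right ((Commute.one_right _).sub_right (hab.mul_right hya.symm))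
        have c5 : Commute x (b * (1 - b * y)) :=
          hxb.mul_right ((Commute.one_right _).sub_right (hxb.mul_right hxy))
        exact c4.mul_left ((Commute.one_left _).sub_left (c4.mul_left c5))
      have c6 : Commute b (a * (a * x)) := hab.symm.mul_right (hab.symm.mul_right hxb.symm)
      exact (c3.mul_right c1).mul_left (c2.mul_right c6)
    convert h1.add_of_commute h2 h12 using 1
    rw [pow_two, mul_assoc (a * b), e]
    have c6 : b * (1 - b * y) * (a * (a * x)) = a * (a * x) * (b * (1 - b * y)) := by
      have c1 : Commute b (a * (a * x)) := hab.symm.mul_right (hab.symm.mul_right hxb.symm)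
      have c2 : Commute y (a * (a * x)) := hya.mul_right (hya.mul_right hxy.symm)
      exact c1.mul_left ((Commute.one_left _).sub_left (c1.mul_left c2))
    rw [c6]
    have c7 : b * (a * x) = a * x * b := (hab.symm.mul_right hxb.symm).eq
    linear_combination (norm := noncomm_ring) - a * c7 * b * y

/-- Cline's formula. -/
theorem mul_comm {b w : A} (h : IsGDrazinInverse (a * b) w) :
    IsGDrazinInverse (b * a) (b * w * w * a) := by
  have h1 := h.mul_mul_self
  have h2 := h.self_mul_mul
  refine ⟨?_, ?_, ?_⟩
  · linear_combination (norm := noncomm_ring)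
      b * w * w * a * b * h2 * a + b * h1 * w * a
  · linear_combination (norm := noncomm_ring) b * h2 * a - b * h1 * a
  · have h3 : IsQuasinilpotent (((1 - a * b * w) * a) * b) := by
      convert h.isQuasinilpotent_one_sub_mul using 1
      noncomm_ring
    convert h3.mul_comm using 1
    linear_combination (norm := noncomm_ring) - b * a * b * h2 * a

theorem of_isIdempotentElem {p : A} (hp : IsIdempotentElem p) : IsGDrazinInverse p p := by
  refine ⟨by rw [hp.eq, hp.eq], rfl, ?_⟩
  rw [pow_two, hp.eq, hp.eq, sub_self]
  exact .zero

theorem inverse (h : IsGDrazinInverse a x) : IsGDrazinInverse x (a * (a * x)) := by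
  have h1 := h.self_mul_mul
  have h2 := h.outer
  have h3 := h.comm
  refine ⟨?_, ?_, ?_⟩
  · linear_combination (norm := noncomm_ring) a * h1 * a * a * x - a * h3 * a * x + a * a * h2
  · linear_combination (norm := noncomm_ring)  a * h2 - h3 * a * x - a * h1
  · convert IsQuasinilpotent.zero (A := A) using 1
    linear_combination (norm := noncomm_ring) - h.mul_mul_self * a * x - h2

theorem mul_mul_inverse (h : IsGDrazinInverse a x) : IsGDrazinInverse (a * (a * x)) x := by
  have h1 := h.inverse
  refine ⟨?_, h1.comm.symm, ?_⟩
  · linear_combination (norm := noncomm_ring) x * a * h.self_mul_mul + h.outer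
  · convert IsQuasinilpotent.zero (A := A) using 1
    linear_combination (norm := noncomm_ring)
      - a * a * x * a * h.self_mul_mul - a * a * h.outer

theorem isQuasinilpotent_iff : IsGDrazinInverse a 0 ↔ IsQuasinilpotent a :=
  ⟨fun h => by simpa using h.quasinilpotent, fun h => ⟨by simp, by simp, by simpa using h⟩⟩

end IsGDrazinInverse

end GDrazin

/-! ### Elements triangular with respect to an idempotent, and the algebra of sums with u v = 0. -/

section Triangular

variable {A : Type*} [NormedRing A] [NormedAlgebra ℂ A]

theorem IsQuasinilpotent.of_norm_pow_le [CompleteSpace A] {q t : A} (hq : IsQuasinilpotent q)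
    (C : ℝ) (h : ∀ n : ℕ, ‖t ^ (n + 1)‖ ≤ C * ‖q ^ (n + 1)‖) : IsQuasinilpotent t := by
  refine isQuasinilpotent_of_tendsto fun r hr => ?_
  have hlim := (hq.tendsto hr).mul_const C
  rw [zero_mul] at hlim
  refine squeeze_zero' (.of_forall fun n => by positivity) ?_ hlim
  filter_upwards [Filter.eventually_gt_atTop 0] with n hn
  obtain ⟨m, rfl⟩ := Nat.exists_eq_add_of_lt hn
  rw [zero_add, mul_assoc, _root_.mul_comm _ C]
  gcongr
  exact h m

theorem IsQuasinilpotent.idem_mul [CompleteSpace A] {q p : A} (hq : IsQuasinilpotent q)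
    (h : p * q * p = p * q) : IsQuasinilpotent (p * q) := by
  have hpow : ∀ n : ℕ, (p * q) ^ (n + 1) = p * q ^ (n + 1) := by
    intro n
    induction n with
    | zero => simp
    | succ n ih => rw [pow_succ', ih, ← mul_assoc, h, mul_assoc, ← pow_succ']
  exact hq.of_norm_pow_le ‖p‖ fun n => by rw [hpow]; exact norm_mul_le _ _

theorem IsQuasinilpotent.mul_idem [CompleteSpace A] {q p : A} (hq : IsQuasinilpotent q)
    (h : p * q * p = q * p) : IsQuasinilpotent (q * p) := by
  have hpow : ∀ n : ℕ, (q * p) ^ (n + 1) = q ^ (n + 1) * p := by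
    intro n
    induction n with
    | zero => simp
    | succ n ih => rw [pow_succ, ih, mul_assoc, ← mul_assoc p, h, ← mul_assoc, ← pow_succ]
  exact hq.of_norm_pow_le ‖p‖ fun n => by
    rw [hpow, _root_.mul_comm ‖p‖]; exact norm_mul_le _ _

namespace IsGDrazinInverse

/-- On triangular elements the compressions s ↦ p s and s ↦ s (1 - p) are multiplicative, so the
defining identities pass to the corners; `idem_mul` and `mul_idem` carry over quasinilpotency. -/
theorem corners [CompleteSpace A] {p s z : A} (hs : p * s * (1 - p) = 0)
    (hz : IsGDrazinInverse s z) (h : p * z * (1 - p) = 0) :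
    IsGDrazinInverse (p * s) (p * z) ∧ IsGDrazinInverse (s * (1 - p)) (z * (1 - p)) := by
  have hs1 : p * s * p = p * s := by linear_combination (norm := noncomm_ring) - hs
  have hz1 : p * z * p = p * z := by linear_combination (norm := noncomm_ring) - h
  have hs2 : (1 - p) * s * (1 - p) = s * (1 - p) := by
    linear_combination (norm := noncomm_ring) - hs
  have hz2 : (1 - p) * z * (1 - p) = z * (1 - p) := by
    linear_combination (norm := noncomm_ring) - h
  set r := 1 - p with hr
  refine ⟨⟨?_, ?_, ?_⟩, ⟨?_, ?_, ?_⟩⟩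
  · linear_combination (norm := noncomm_ring)
      p * z * hs1 * z + hz1 * s * z + p * hz.outer
  · linear_combination (norm := noncomm_ring) hs1 * z - hz1 * s + p * hz.comm
  · have hs3 : p * s * s * p = p * s * s := by
      linear_combination (norm := noncomm_ring) p * s * hs1 + hs1 * s - hs1 * s * p
    have h1 : p * (s - s ^ 2 * z) * p = p * (s - s ^ 2 * z) := by
      linear_combination (norm := noncomm_ring)
        hs1 - p * s * s * hz1 + hs3 * z * p - hs3 * z
    convert hz.quasinilpotent.idem_mul h1 using 1
    linear_combination (norm := noncomm_ring) - hs1 * s * p * z - hs3 * z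
  · linear_combination (norm := noncomm_ring)
      z * hs2 * z * r + z * s * hz2 + hz.outer * r
  · linear_combination (norm := noncomm_ring) s * hz2 - z * hs2 + hz.comm * r
  · have hs3 : r * s * s * r = s * s * r := by
      linear_combination (norm := noncomm_ring) hs2 * s * r + s * hs2 - r * s * hs2
    have h1 : r * (s - s ^ 2 * z) * r = (s - s ^ 2 * z) * r := by
      linear_combination (norm := noncomm_ring)
        hs2 + r * s * s * hz2 - hs3 * z * r - s * s * hz2
    convert hz.quasinilpotent.mul_idem h1 using 1
    linear_combination (norm := noncomm_ring) - s * hs2 * z * r - s * s * hz2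

/-- The point is that p z = x, and x (1 - p) = 0. With e = p s x, the vanishing device gives e (1 -
s z) = 0 and (1 - e) p s z = 0, hence p s z = e, from which p z = x follows. -/
theorem corner_eq_zero_left [CompleteSpace A] {p s z x : A}
    (hs : p * s * (1 - p) = 0) (hz : IsGDrazinInverse s z) (hx : IsGDrazinInverse (p * s) x) :
    p * z * (1 - p) = 0 := by
  have hs1 : p * s * p = p * s := by linear_combination (norm := noncomm_ring) - hs
  set e := p * s * x with he
  have hxc : p * s * x = x * (p * s) := hx.comm
  have hep : e * p = e := by
    rw [he]; linear_combination (norm := noncomm_ring) hxc * p + x * hs1 - hxc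
  have hxe : x * e = x := by rw [he, ← mul_assoc, hx.outer]
  have h1 : e * (1 - s * z) = 0 := by
    refine hz.isQuasinilpotent_mul_one_sub.eq_zero_of_eq_mul_mul (x := x) ?_
    have hxe' : x * e * (p * s) = e := by
      linear_combination (norm := noncomm_ring) hxe * (p * s) - hxc - he
    linear_combination (norm := noncomm_ring) - x * e * hz.one_sub_mul_mul_one_sub
      + x * hep * s * (1 - s * z) - hxe' * (1 - s * z)
  have h2 : (1 - e) * (p * s * z) = 0 := by
    refine hx.isQuasinilpotent_mul_one_sub.eq_zero_of_eq_mul_mul' (x := z) ?_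
    have hE := hx.mul_one_sub
    have hEE := hx.one_sub_mul_one_sub
    rw [← he] at hE hEE ⊢
    linear_combination (norm := noncomm_ring) - p * s * hEE * p * s * z * z
      - p * s * (1 - e) * p * hz.self_mul_mul - hE * p * z - (1 - e) * hs1 * z
  have h3 : p * s * z = e := by
    linear_combination (norm := noncomm_ring) h2 + hep * s * z - h1
  have h4 : p * z = x := by
    calc p * z = p * s * z * z := by
          linear_combination (norm := noncomm_ring) - p * hz.self_mul_mul
      _ = e * z := by rw [h3]
      _ = x * (p * s * z) := by rw [he, hxc]; simp only [mul_assoc]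
      _ = x := by rw [h3, hxe]
  rw [h4]
  linear_combination (norm := noncomm_ring) - hx.mul_mul_self + hx.mul_mul_self * p - x * x * hs1

/-- Mirror image of `corner_eq_zero_left`: here z (1 - p) = y, and p y = 0. -/
theorem corner_eq_zero_right [CompleteSpace A] {p s z y : A} (hp : IsIdempotentElem p)
    (hs : p * s * (1 - p) = 0) (hz : IsGDrazinInverse s z)
    (hy : IsGDrazinInverse (s * (1 - p)) y) : p * z * (1 - p) = 0 := by
  have hs2 : (1 - p) * s * (1 - p) = s * (1 - p) := by
    linear_combination (norm := noncomm_ring) - hs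
  have hpr : p * (1 - p) = 0 := hp.mul_one_sub_self
  set r := 1 - p with hr
  set f := s * r * y with hf
  have hrf : r * f = f := by
    rw [hf]; linear_combination (norm := noncomm_ring) hs2 * y
  have hfy : f * y = y := hy.self_mul_mul
  have hQQ := hz.one_sub_mul_one_sub
  have hQ := hz.mul_one_sub
  have hF := hy.mul_one_sub
  have hFF := hy.one_sub_mul_one_sub
  have h1 : (1 - s * z) * f = 0 := by
    refine hz.isQuasinilpotent_mul_one_sub.eq_zero_of_eq_mul_mul' (x := y) ?_
    linear_combination (norm := noncomm_ring) - s * hQQ * f * y - hQ * f * y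
      + (1 - s * z) * s * hrf * y - (1 - s * z) * s * r * hfy + (1 - s * z) * hf
  have h2 : z * s * r * (1 - f) = 0 := by
    refine hy.isQuasinilpotent_mul_one_sub.eq_zero_of_eq_mul_mul (x := z) ?_
    rw [← hf] at hF hFF ⊢
    linear_combination (norm := noncomm_ring) z * z * s * r * hF * (1 - f)
      - z * z * s * r * s * r * hFF - z * z * s * hs2 * (1 - f)
      - hz.mul_mul_self * s * r * (1 - f)
  have h3 : z * s * r = f := by
    linear_combination (norm := noncomm_ring) h2 + z * s * hrf - hz.comm * f - h1
  have h4 : z * r = y := by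
    linear_combination (norm := noncomm_ring)
      - hz.mul_mul_self * r + z * h3 + z * hf + h3 * y + hfy
  linear_combination (norm := noncomm_ring) p * h4 - p * hfy - p * hrf * y + hpr * f * y

/-- Here α and β stand for Σ (1 - v y) vⁿ xⁿ⁺¹ and Σ yⁿ⁺¹ uⁿ (1 - u x). The hypotheses are the
absorption laws and first-term recursions of these series, which are all that is needed, so the
verification is free of limits. -/
theorem add_of_series [CompleteSpace A] {u v x y α β : A} (hu : IsGDrazinInverse u x)
    (hv : IsGDrazinInverse v y) (huv : u * v = 0) (hα₁ : α * x * u = α)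
    (hα₂ : α = (1 - v * y) * x + v * α * x) (hα₃ : (1 - v * y) * α = α)
    (hβ₁ : v * y * β = β) (hβ₂ : β = y * (1 - u * x) + y * β * u) (hβ₃ : β * (1 - u * x) = β) :
    IsGDrazinInverse (u + v) (α + β) := by
  have hux := hu.comm
  have hvy := hv.comm
  have xv : x * v = 0 := by
    linear_combination (norm := noncomm_ring) - hu.mul_mul_self * v + x * x * huv
  have αv : α * v = 0 := by
    linear_combination (norm := noncomm_ring) - hα₁ * v + α * x * huv
  have uα : u * α = u * x := by
    linear_combination (norm := noncomm_ring) u * hα₂ - huv * y * x + huv * α * x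
  have αu : α * u = (1 - v * y) * x * u + v * α := by
    linear_combination (norm := noncomm_ring) hα₂ * u + v * hα₁
  have uβ : u * β = 0 := by
    linear_combination (norm := noncomm_ring) - u * hβ₁ + huv * y * β
  have βv : β * v = y * v := by
    linear_combination (norm := noncomm_ring) hβ₂ * v - y * u * xv + y * β * huv
  have vβ : v * β = v * y * (1 - u * x) + β * u := by
    linear_combination (norm := noncomm_ring) v * hβ₂ + hβ₁ * u
  have αβ : α * β = 0 := by
    linear_combination (norm := noncomm_ring) - hα₁ * β + α * x * uβ
  have αux : α * (u * x) = α := by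
    linear_combination (norm := noncomm_ring) α * hux + hα₁
  have βux : β * (u * x) = 0 := by
    linear_combination (norm := noncomm_ring) - hβ₃
  have yvα : y * v * α = 0 := by
    linear_combination (norm := noncomm_ring) - hα₃ - hvy * α
  have uxβ : u * x * β = 0 := by
    linear_combination (norm := noncomm_ring) hux * β + x * uβ
  have ββ : β * β = y * β := by
    linear_combination (norm := noncomm_ring) hβ₂ * β - y * uxβ + y * β * uβ
  have hw : (u + v) * (α + β) = u * x + v * α + v * y * (1 - u * x) + β * u := by
    linear_combination (norm := noncomm_ring) uα + uβ + vβ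
  have hw' : (α + β) * (u + v) = u * x + v * α + v * y * (1 - u * x) + β * u := by
    linear_combination (norm := noncomm_ring) αv + αu + βv - hvy - hux + v * y * hux
  have hz : (α + β) * (u * x + v * α + v * y * (1 - u * x) + β * u) = α + β := by
    linear_combination (norm := noncomm_ring) αux + αv * α + αv * y * (1 - u * x) + αβ * u
      + βux + βv * α + yvα + βv * y * (1 - u * x) + hv.outer * (1 - u * x) + ββ * u - hβ₂
  have hc := hw.trans hw'.symm
  set w := u * x + v * α + v * y * (1 - u * x) + β * u with hwdef
  have huw : u * (1 - w) = u * (1 - u * x) := by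
    rw [hwdef]
    linear_combination (norm := noncomm_ring) - huv * α - huv * y * (1 - u * x) - uβ * u
  have hwv : (1 - w) * v = (1 - v * y) * v := by
    rw [hwdef]
    linear_combination (norm := noncomm_ring) - u * xv - v * αv + v * y * u * xv - β * huv
  have hwi : w * w = w := by
    calc w * w = (u + v) * ((α + β) * w) := by rw [← hw]; simp only [mul_assoc]
      _ = w := by rw [hz, hw]
  have hws : (u + v) * w = w * (u + v) := by
    rw [← hw, mul_assoc, ← hc]
  refine ⟨by rw [mul_assoc, hw, hz], hc, ?_⟩
  -- The residual (1 - w)(u + v)(1 - w) splits into a u-part and a v-part. Cyclic permutation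
  -- reduces each to the quasinilpotent part of u or v, and their product in this order is 0.
  have hU : IsQuasinilpotent ((1 - w) * (u * (1 - u * x))) := by
    refine IsQuasinilpotent.mul_comm ?_
    have : u * (1 - u * x) * (1 - w) = (1 - u * x) * u * (1 - u * x) := by
      linear_combination (norm := noncomm_ring) (1 - u * x) * huw + hu.mul_one_sub * (1 - w)
    rw [this, hu.one_sub_mul_mul_one_sub]
    exact hu.isQuasinilpotent_mul_one_sub
  have hV : IsQuasinilpotent ((1 - v * y) * v * (1 - w)) := by
    refine IsQuasinilpotent.mul_comm ?_
    have h1 : (1 - w) * ((1 - v * y) * v) = v * (1 - v * y) := by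
      linear_combination (norm := noncomm_ring) - (1 - w) * hv.mul_one_sub
        + hwv * (1 - v * y) + hv.one_sub_mul_mul_one_sub
    rw [h1]
    exact hv.isQuasinilpotent_mul_one_sub
  have hUV : (1 - w) * (u * (1 - u * x)) * ((1 - v * y) * v * (1 - w)) = 0 := by
    linear_combination (norm := noncomm_ring)
      (1 - w) * hu.mul_one_sub * ((1 - v * y) * v * (1 - w))
      - (1 - w) * (1 - u * x) * u * hv.mul_one_sub * (1 - w)
      + (1 - w) * (1 - u * x) * huv * (1 - v * y) * (1 - w)
  convert hU.add_of_mul_eq_zero hV hUV using 1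
  rw [pow_two, mul_assoc, hw, ← huw, ← hwv]
  linear_combination (norm := noncomm_ring) - hws + hws * w - (u + v) * hwi

end IsGDrazinInverse
end Triangular

/-! ### Series for the inverse of a sum, of a triangular element, and of a quasinilpotent
perturbation. -/

section Sum

variable {A : Type*} [NormedRing A] [NormedAlgebra ℂ A] [CompleteSpace A]

namespace IsGDrazinInverse

/-- The generalized Drazin inverse of a sum `u + v` with `u v = 0`. -/
theorem add_of_mul_eq_zero {u v x y : A} (hu : IsGDrazinInverse u x) (hv : IsGDrazinInverse v y)
    (huv : u * v = 0) :
    Summable (fun n : ℕ => (1 - v * y) * v ^ n * x ^ (n + 1)) ∧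
      Summable (fun n : ℕ => y ^ (n + 1) * u ^ n * (1 - u * x)) ∧
      IsGDrazinInverse (u + v) ((∑' n : ℕ, (1 - v * y) * v ^ n * x ^ (n + 1))
        + ∑' n : ℕ, y ^ (n + 1) * u ^ n * (1 - u * x)) := by
  have hP : ∀ {w z : A}, IsGDrazinInverse w z → ∀ n : ℕ,
      (w * (1 - w * z)) ^ n * (1 - w * z) = w ^ n * (1 - w * z) := by
    intro w z h n
    rw [Commute.mul_pow h.mul_one_sub_comm, mul_assoc, ← pow_succ,
      IsIdempotentElem.pow_succ_eq n h.one_sub_mul_one_sub]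
  have hQc : ∀ n : ℕ, (1 - v * y) * v ^ n = v ^ n * (1 - v * y) := fun n =>
    (hv.mul_one_sub_comm.pow_left n).symm.eq
  have hf : Summable (fun n : ℕ => (1 - v * y) * v ^ n * x ^ (n + 1)) := by
    refine (hv.isQuasinilpotent_mul_one_sub.summable_pow_mul_mul_pow
      ((1 - v * y) * x) x).congr fun n => ?_
    rw [← mul_assoc, hP hv, hQc, pow_succ']
    simp only [mul_assoc]
  have hg : Summable (fun n : ℕ => y ^ (n + 1) * u ^ n * (1 - u * x)) := by
    refine ((hu.isQuasinilpotent_mul_one_sub.summable_pow_mul_mul_pow' y y).mul_right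
      (1 - u * x)).congr fun n => ?_
    rw [mul_assoc, hP hu, pow_succ]
    simp only [mul_assoc]
  refine ⟨hf, hg, add_of_series hu hv huv ?_ ?_ ?_ ?_ ?_ ?_⟩
  · rw [← hf.tsum_mul_right, ← (hf.mul_right x).tsum_mul_right]
    refine tsum_congr fun n => ?_
    rw [pow_succ]
    linear_combination (norm := noncomm_ring) (1 - v * y) * v ^ n * x ^ n * hu.mul_mul_self
  · rw [← hf.tsum_mul_left, ← (hf.mul_left v).tsum_mul_right, hf.tsum_eq_zero_add]
    simp only [pow_zero, mul_one, zero_add, pow_one]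
    congr 1
    refine tsum_congr fun n => ?_
    rw [hQc, hQc, pow_succ x (n + 1), pow_succ' v]
    simp only [mul_assoc]
  · rw [← hf.tsum_mul_left]
    refine tsum_congr fun n => ?_
    rw [← mul_assoc, ← mul_assoc, hv.one_sub_mul_one_sub]
  · rw [← hg.tsum_mul_left]
    refine tsum_congr fun n => ?_
    rw [pow_succ', ← mul_assoc, ← mul_assoc, ← mul_assoc, hv.self_mul_mul]
  · rw [← hg.tsum_mul_left, ← (hg.mul_left y).tsum_mul_right, hg.tsum_eq_zero_add]
    simp only [pow_zero, mul_one, zero_add, pow_one]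
    congr 1
    refine tsum_congr fun n => ?_
    rw [pow_succ' y (n + 1), pow_succ u]
    linear_combination (norm := noncomm_ring) y * y ^ (n + 1) * u ^ n * hu.mul_one_sub
  · rw [← hg.tsum_mul_right]
    refine tsum_congr fun n => ?_
    rw [mul_assoc, hu.one_sub_mul_one_sub]

/-- The generalized Drazin inverse of an element that is lower triangular with respect to an
idempotent. -/
theorem triangular {p s x y : A} (hp : IsIdempotentElem p) (hs : p * s * (1 - p) = 0)
    (hx : IsGDrazinInverse (p * s) x) (hy : IsGDrazinInverse (s * (1 - p)) y) :
    Summable (fun n : ℕ =>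
      (1 - s * (1 - p) * y) * (s * (1 - p)) ^ n * (1 - p) * s * x ^ (n + 2)) ∧
    Summable (fun n : ℕ => y ^ (n + 2) * (1 - p) * s * p * (p * s) ^ n * (1 - p * s * x)) ∧
    IsGDrazinInverse s (x
      + (∑' n : ℕ, (1 - s * (1 - p) * y) * (s * (1 - p)) ^ n * (1 - p) * s * x ^ (n + 2))
      + (y - y * s * x)
      + ∑' n : ℕ, y ^ (n + 2) * (1 - p) * s * p * (p * s) ^ n * (1 - p * s * x)) := by
  have hs1 : p * s * p = p * s := by linear_combination (norm := noncomm_ring) - hs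
  have hpp : p * p = p := hp
  have hxp : x * p = x := by
    linear_combination (norm := noncomm_ring)
      - hx.mul_mul_self * p + x * x * hs1 + hx.mul_mul_self
  have hyp : y * p = 0 := by
    linear_combination (norm := noncomm_ring)
      - hy.mul_mul_self * p - y * y * s * hpp
  -- Cline's formula moves the inverse from p s to s p, so that s = s p + s (1 - p) is a sum whose
  -- product in this order is 0.
  have hu : IsGDrazinInverse (s * p) (s * x * x) := by
    have := hx.mul_comm
    rwa [mul_assoc _ x p, hxp] at this
  have huv : s * p * (s * (1 - p)) = 0 := by
    linear_combination (norm := noncomm_ring) s * hs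
  have hux : s * p * (s * x * x) = s * x := by
    linear_combination (norm := noncomm_ring) s * hx.self_mul_mul
  have hX : ∀ n : ℕ, (s * x * x) ^ (n + 1) = s * x ^ (n + 2) := by
    intro n
    induction n with
    | zero => simp [pow_two, mul_assoc]
    | succ n ih =>
      rw [pow_succ, ih, pow_succ x (n + 2), pow_succ x (n + 1)]
      linear_combination (norm := noncomm_ring) s * x ^ (n + 1) * (hx.outer * x)
        - s * x ^ (n + 1) * hxp * s * x * x
  obtain ⟨hf, hg, hz⟩ := hu.add_of_mul_eq_zero hy huv
  simp only [hX, hux] at hf hg hz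
  have hvp : s * (1 - p) * p = 0 := by linear_combination (norm := noncomm_ring) - s * hpp
  have hc : ∀ n : ℕ, (s * p) ^ (n + 1) = s * p * (p * s) ^ n * p := by
    intro n
    induction n with
    | zero => simp [mul_assoc, hpp]
    | succ n ih =>
      rw [pow_succ', ih, pow_succ' (p * s)]
      linear_combination (norm := noncomm_ring) s * hs1 * (p * s) ^ n * p - s * hpp * s * (p * s) ^ n * p
  have hcp : ∀ n : ℕ, p * (p * s) ^ n * p = p * (p * s) ^ n := by
    intro n
    cases n with
    | zero => simp [hpp]
    | succ n => rw [pow_succ]; linear_combination (norm := noncomm_ring) p * (p * s) ^ n * hs1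
  have hg' : ∀ n : ℕ, y ^ (n + 1 + 1) * (s * p) ^ (n + 1) * (1 - s * x) =
      y ^ (n + 2) * (1 - p) * s * p * (p * s) ^ n * (1 - p * s * x) := by
    intro n
    rw [hc, pow_succ]
    linear_combination (norm := noncomm_ring) y ^ (n + 1) * y * s * hcp n
      + y ^ (n + 1) * hyp * s * p * (p * s) ^ n * (1 - p * s * x)
  have hf' : ∀ n : ℕ, (1 - s * (1 - p) * y) * (s * (1 - p)) ^ (n + 1) * (s * x ^ (n + 1 + 2)) =
      (1 - s * (1 - p) * y) * (s * (1 - p)) ^ (n + 1) * (1 - p) * s * x ^ (n + 1 + 2) := by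
    intro n
    rw [pow_succ (s * (1 - p))]
    linear_combination (norm := noncomm_ring)
      (1 - s * (1 - p) * y) * (s * (1 - p)) ^ n * hvp * s * x ^ (n + 1 + 2)
  have hF : Summable (fun n : ℕ =>
      (1 - s * (1 - p) * y) * (s * (1 - p)) ^ n * (1 - p) * s * x ^ (n + 2)) :=
    (summable_nat_add_iff 1).1 (((summable_nat_add_iff 1).2 hf).congr hf')
  have hG := ((summable_nat_add_iff 1).2 hg).congr hg'
  refine ⟨hF, hG, ?_⟩
  convert hz using 1
  · noncomm_ring
  -- The initial terms account for the isolated summands: those of the two first series differ by x,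
  -- and that of the second is y - y s x.
  · rw [hf.tsum_eq_zero_add, hF.tsum_eq_zero_add, hg.tsum_eq_zero_add, tsum_congr hf',
      tsum_congr hg']
    simp only [pow_zero, mul_one, zero_add, pow_one, pow_two]
    linear_combination (norm := noncomm_ring) - hx.self_mul_mul + s * (1 - p) * hyp * s * x * x

/-- A perturbation of `b` by a quasinilpotent element. -/
theorem add_quasinilpotent {q b y : A} (hq : IsQuasinilpotent q) (hb : IsGDrazinInverse b y)
    (h : q * b = (1 - b * y) * b * q * (1 - b * y)) :
    Summable (fun n : ℕ => y ^ (n + 1) * q ^ n) ∧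
      IsGDrazinInverse (q + b) (∑' n : ℕ, y ^ (n + 1) * q ^ n) ∧
      (∑' n : ℕ, y ^ (n + 1) * q ^ n) * b = b * y ∧
      ∀ m : ℕ, (∑' n : ℕ, y ^ (n + 1) * q ^ n) ^ (m + 1) =
        y ^ m * ∑' n : ℕ, y ^ (n + 1) * q ^ n := by
  have hQy : (1 - b * y) * y = 0 := by
    linear_combination (norm := noncomm_ring) - hb.self_mul_mul
  have hQ := hb.mul_one_sub
  have hqf : q * b * y = 0 := by
    linear_combination (norm := noncomm_ring) h * y + (1 - b * y) * b * q * hQy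
  have hqQ : q * (1 - b * y) = q := by linear_combination (norm := noncomm_ring) - hqf
  have hqb : q * b = (1 - b * y) * b * q := by
    linear_combination (norm := noncomm_ring) h + (1 - b * y) * b * hqQ
  have hcomm : q * (b * (1 - b * y)) = b * (1 - b * y) * q := by
    linear_combination (norm := noncomm_ring) hqb * (1 - b * y) + (1 - b * y) * b * hqQ - hQ * q
  have hyb : y * (b * (1 - b * y)) = 0 := by
    linear_combination (norm := noncomm_ring) - hb.outer * b - y * b * hb.comm
  have hqn : ∀ n : ℕ, y * q ^ n * (b * (1 - b * y)) = 0 := fun n => by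
    rw [mul_assoc, ((show Commute q _ from hcomm).pow_left n).eq, ← mul_assoc, hyb, zero_mul]
  have hpow : ∀ n : ℕ, y * (q + b * (1 - b * y)) ^ n = y * q ^ n := by
    intro n
    induction n with
    | zero => simp
    | succ n ih => rw [pow_succ, ← mul_assoc, ih, mul_add, hqn, add_zero, pow_succ, mul_assoc]
  -- The sum is regrouped as q + b = (q + b(1 - b y)) + b² y: a quasinilpotent u and a v with
  -- inverse y, u v = 0. For u, the commuting pieces (1 - b y) q and b(1 - b y) are added first,
  -- then b y q, whose square is 0.
  have hu : IsQuasinilpotent (q + b * (1 - b * y)) := by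
    have h1 : IsQuasinilpotent ((1 - b * y) * q) := by
      refine IsQuasinilpotent.mul_comm ?_
      rwa [hqQ]
    have h2 : Commute ((1 - b * y) * q) (b * (1 - b * y)) := by
      show _ = _
      linear_combination (norm := noncomm_ring) (1 - b * y) * hcomm - hQ * (1 - b * y) * q
    have h3 : IsQuasinilpotent (b * y * q) := by
      refine isQuasinilpotent_of_mul_self_eq_zero ?_
      linear_combination (norm := noncomm_ring) b * y * hqf * q
    have h4 : ((1 - b * y) * q + b * (1 - b * y)) * (b * y * q) = 0 := by
      linear_combination (norm := noncomm_ring) (1 - b * y) * hqf * q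
        - b * hQ * y * q + b * b * hQy * q
    convert (h1.add_of_commute hb.isQuasinilpotent_mul_one_sub h2).add_of_mul_eq_zero h3 h4 using 1
    noncomm_ring
  have huv : (q + b * (1 - b * y)) * (b * (b * y)) = 0 := by
    linear_combination (norm := noncomm_ring) hqb * b * y + (1 - b * y) * b * hqf
      - b * hQ * b * y - b * b * hQ * y + b * b * b * hQy
  obtain ⟨-, hg, hz⟩ :=
    (isQuasinilpotent_iff.2 hu).add_of_mul_eq_zero hb.mul_mul_inverse huv
  have he : ∀ n : ℕ, y ^ (n + 1) * (q + b * (1 - b * y)) ^ n *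
      (1 - (q + b * (1 - b * y)) * 0) = y ^ (n + 1) * q ^ n := by
    intro n
    rw [mul_zero, sub_zero, mul_one, pow_succ, mul_assoc, hpow, mul_assoc]
  simp only [he] at hg hz
  have h0 : ∀ n : ℕ, (1 - b * (b * y) * y) * (b * (b * y)) ^ n * (0 : A) ^ (n + 1) = 0 := by
    intro n
    rw [zero_pow n.succ_ne_zero, mul_zero]
  simp only [h0, tsum_zero, zero_add] at hz
  have hYb : (∑' n : ℕ, y ^ (n + 1) * q ^ n) * b = b * y := by
    rw [← hg.tsum_mul_right, (hg.mul_right b).tsum_eq_zero_add]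
    have : ∀ n : ℕ, y ^ (n + 1 + 1) * q ^ (n + 1) * b = 0 := by
      intro n
      rw [pow_succ y, pow_succ q]
      linear_combination (norm := noncomm_ring) y ^ (n + 1) * y * q ^ n * hqb
        - y ^ (n + 1) * y * q ^ n * hQ * q + y ^ (n + 1) * hqn n * q
    simp [this, hb.comm]
  set Y := ∑' n : ℕ, y ^ (n + 1) * q ^ n with hY
  have hYy : Y * y = y * y := by
    linear_combination (norm := noncomm_ring)
      - Y * hb.self_mul_mul + hYb * y * y + hb.self_mul_mul * y
  have hYY : Y * Y = y * Y := by
    conv_lhs => rw [hY, ← hg.tsum_mul_left]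
    conv_rhs => rw [hY, ← hg.tsum_mul_left]
    refine tsum_congr fun n => ?_
    rw [pow_succ', ← mul_assoc, ← mul_assoc, hYy]
    simp only [mul_assoc]
  refine ⟨hg, ?_, hYb, fun m => ?_⟩
  · convert hz using 1
    noncomm_ring
  · induction m with
    | zero => simp
    | succ m ih => rw [pow_succ, ih, mul_assoc, hYY, ← mul_assoc, ← pow_succ]

end IsGDrazinInverse
end Sum

/-! ### The corners of b and of a + b for the idempotent a aᵈ. -/

section Corners

variable {A : Type*} [NormedRing A] [NormedAlgebra ℂ A] 

namespace IsGDrazinInverse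

theorem isIdempotentElem_mul {a x : A} (ha : IsGDrazinInverse a x) :
    IsIdempotentElem (a * x) := by
  show _ = _
  linear_combination (norm := noncomm_ring) a * ha.outer

/-- Commutation carries a across t = a x b (1 - a x), giving t = x t (a (1 - a x)). -/
theorem mul_mul_one_sub_eq_zero [CompleteSpace A] {a x b : A} (ha : IsGDrazinInverse a x)
    (h : Commute a (a * x * b)) : a * x * b * (1 - a * x) = 0 := by
  have h : a * (a * x * b) = a * x * b * a := h
  refine ha.isQuasinilpotent_mul_one_sub.eq_zero_of_eq_mul_mul (x := x) ?_
  linear_combination (norm := noncomm_ring) - x * a * x * b * ha.one_sub_mul_mul_one_sub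
    + x * h * (1 - a * x) + ha.comm * a * x * b * (1 - a * x)
    - a * ha.outer * b * (1 - a * x)

/-- Triangularity and Cline's formula reduce the six alternatives to two: p b or b (1 - p) is
invertible in the generalized sense. -/
theorem corners_of_isGDrazinInvertible [CompleteSpace A] {p b z : A} (hp : IsIdempotentElem p)
    (hb : IsGDrazinInverse b z) (hpb : p * b * (1 - p) = 0)
    (h : IsGDrazinInvertible ((1 - p) * b * (1 - p)) ∨ IsGDrazinInvertible ((1 - p) * b) ∨
      IsGDrazinInvertible (b * (1 - p)) ∨ IsGDrazinInvertible (p * b * p) ∨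
      IsGDrazinInvertible (p * b) ∨ IsGDrazinInvertible (b * p)) :
    p * z * (1 - p) = 0 := by
  have h1 : (1 - p) * b * (1 - p) = b * (1 - p) := by
    linear_combination (norm := noncomm_ring) - hpb
  have h2 : p * b * p = p * b := by
    linear_combination (norm := noncomm_ring) - hpb
  rw [h1, h2] at h
  rcases h with ⟨y, hy⟩ | ⟨y, hy⟩ | ⟨y, hy⟩ | ⟨y, hy⟩ | ⟨y, hy⟩ | ⟨y, hy⟩
  · exact corner_eq_zero_right hp hpb hb hy
  · exact corner_eq_zero_right hp hpb hb hy.mul_comm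
  · exact corner_eq_zero_right hp hpb hb hy
  · exact corner_eq_zero_left hpb hb hy
  · exact corner_eq_zero_left hpb hb hy
  · exact corner_eq_zero_left hpb hb hy.mul_comm

/-- The quasinilpotent corner of `a + b`. -/
theorem mul_corner_eq {R : Type*} [Ring R] {a b z p : R} (hp : IsIdempotentElem p) (hpa : Commute a p)
    (hpb : p * b * (1 - p) = 0) (hpz : p * z * (1 - p) = 0)
    (hab : a * b * (1 - p) = (1 - p) * (1 - b * z) * b * a * (1 - b * z) * (1 - p)) :
    a * (1 - p) * (b * (1 - p)) = (1 - b * (1 - p) * (z * (1 - p))) * (b * (1 - p)) *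
      (a * (1 - p)) * (1 - b * (1 - p) * (z * (1 - p))) := by
  have hrr : (1 - p) * (1 - p) = 1 - p := hp.one_sub
  have hra : (1 - p) * a = a * (1 - p) := ((Commute.one_right a).sub_right hpa).eq.symm
  have hb : (1 - p) * b * (1 - p) = b * (1 - p) := by
    linear_combination (norm := noncomm_ring) - hpb
  have hz : (1 - p) * z * (1 - p) = z * (1 - p) := by
    linear_combination (norm := noncomm_ring) - hpz
  generalize 1 - p = r at *
  have e1 : b * r * (z * r) = b * z * r := by
    linear_combination (norm := noncomm_ring) b * hz
  have e2 : r * b * z * r = b * z * r := by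
    linear_combination (norm := noncomm_ring) - r * b * hz + hb * z * r + b * hz
  rw [e1, mul_assoc a r, ← mul_assoc r, hb, ← mul_assoc, hab]
  have e3 : (1 - b * z) * r = r * (1 - b * z * r) := by
    linear_combination (norm := noncomm_ring) e2
  have e4 : r * (1 - b * z) * b * r = (1 - b * z * r) * (b * r) := by
    linear_combination (norm := noncomm_ring)
      hb + r * b * z * hb - e2 * b * r
  calc r * (1 - b * z) * b * a * (1 - b * z) * r
      = r * (1 - b * z) * b * a * (r * (1 - b * z * r)) := by rw [← e3, mul_assoc _ _ r]
    _ = r * (1 - b * z) * b * (a * r) * (1 - b * z * r) := by simp only [mul_assoc]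
    _ = r * (1 - b * z) * b * (a * r * r) * (1 - b * z * r) := by rw [mul_assoc a, hrr]
    _ = r * (1 - b * z) * b * r * (a * r) * (1 - b * z * r) := by
      linear_combination (norm := noncomm_ring)
        - (r * (1 - b * z) * b) * hra * r * (1 - b * z * r)
    _ = _ := by rw [e4]

/-- A geometric series for the part of `(a + b)ᵈ` on which `a` is invertible and `b` is
quasinilpotent. -/
theorem mul_one_sub_eq_tsum [CompleteSpace A] {a x b z w : A} (ha : IsGDrazinInverse a x)
    (h : Commute a (a * x * b)) (hb : IsGDrazinInverse (a * x * b) (a * x * z))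
    (hpb : a * x * b * (1 - a * x) = 0)
    (hc : IsGDrazinInverse (a * x * (a + b)) w) :
    Summable (fun n : ℕ => a * x * (1 - b * z) * (-b) ^ n * x ^ (n + 1)) ∧
      w * (1 - b * z) = ∑' n : ℕ, a * x * (1 - b * z) * (-b) ^ n * x ^ (n + 1) := by
  have hp : a * x * (a * x) = a * x := ha.isIdempotentElem_mul
  set p := a * x with hpdef
  have hax : Commute a x := ha.comm
  have hap : Commute a p := (Commute.refl a).mul_right hax
  have hxp : Commute x p := hax.symm.mul_right (Commute.refl x)
  have hxb : Commute x (p * b) := ha.commute h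
  have hpb' : Commute p (p * b) := h.mul_left hxb
  have hza : Commute (p * z) a := hb.commute h.symm
  have hzx : Commute (p * z) x := hb.commute hxb.symm
  have hzp : Commute (p * z) p := hza.mul_right hzx
  have hzb : Commute (p * z) (p * b) := hb.comm.symm
  have hceq : p * (a + b) = a * p + p * b := by rw [mul_add, hap.eq]
  have hq : p * (1 - b * z) = p * (1 - p * b * (p * z)) := by
    linear_combination (norm := noncomm_ring) - hpb * z + hp * b * p * z
  have he : ∀ y : A, Commute y p → Commute y (p * b) → Commute y (p * z) →
      Commute y (p * (1 - p * b * (p * z))) := fun y h1 h2 h3 =>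
    h1.mul_right ((Commute.one_right y).sub_right (h2.mul_right h3))
  have hqq : p * (1 - p * b * (p * z)) * (p * (1 - p * b * (p * z))) =
      p * (1 - p * b * (p * z)) := by
    have h1 := hb.one_sub_mul_one_sub
    have h2 : (1 - p * b * (p * z)) * p = p * (1 - p * b * (p * z)) :=
      ((Commute.one_left p).sub_left (hpb'.symm.mul_left hzp)).eq
    linear_combination (norm := noncomm_ring) p * h2 * (1 - p * b * (p * z))
      + hp * (1 - p * b * (p * z)) * (1 - p * b * (p * z)) + p * h1
  rw [hq]
  have hqe : p * (1 - p * b * (p * z)) * (1 - p * b * (p * z)) = p * (1 - p * b * (p * z)) := by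
    rw [mul_assoc, hb.one_sub_mul_one_sub]
  have hqp : p * (p * (1 - p * b * (p * z))) = p * (1 - p * b * (p * z)) := by
    rw [← mul_assoc, hp]
  have hqa := he a hap h hza.symm
  have hqx := he x hxp hxb hzx.symm
  have hqb := he (p * b) hpb'.symm (Commute.refl _) hzb.symm
  have hqP := he p (Commute.refl _) hpb' hzp.symm
  have hqz := he (p * z) hzp hzb (Commute.refl _)
  have hqE := (Commute.one_right _).sub_right (hqb.symm.mul_right hqz.symm)
  have hqc : Commute (a * p + p * b) (p * (1 - p * b * (p * z))) :=
    (hqa.mul_left hqP).add_left hqb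
  have hwp : w * p = w := by
    have h1 := hc.mul_mul_self
    rw [hceq] at h1
    linear_combination (norm := noncomm_ring) - h1 * p + w * w * a * hp + h1
      - w * w * hpb
  have hquasi : IsQuasinilpotent (- (p * b * (1 - p * b * (p * z)))) := by
    rw [← mul_neg_one]
    exact hb.isQuasinilpotent_mul_one_sub.mul_of_commute (Commute.neg_one_right _)
  have hw1 : w * (1 - b * z) = w * (p * (1 - p * b * (p * z))) := by
    rw [← hq, ← mul_assoc, hwp]
  rw [hw1]
  have hE : Commute (p * b) (1 - p * b * (p * z)) := hb.mul_one_sub_comm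
  generalize he' : 1 - p * b * (p * z) = e at *
  generalize hqdef : p * e = q at *
  -- Behind q, b may be replaced by p b, which commutes with a, x and q; b itself need not.
  have hpow : ∀ n : ℕ, q * (-b) ^ n = q * (-(p * b)) ^ n := by
    intro n
    induction n with
    | zero => simp
    | succ n ih =>
      have h1 : q * (-(p * b)) ^ n = (-(p * b)) ^ n * q := (hqb.neg_left.pow_left n).eq.symm
      have h2 : q * p = q := by rw [← hqP.eq, hqp]
      rw [pow_succ, ← mul_assoc, ih, pow_succ, ← mul_assoc, h1]
      linear_combination (norm := noncomm_ring) (-(p * b)) ^ n * h2 * b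
  simp only [hpow]
  have hsum : Summable (fun n : ℕ => q * (-(p * b)) ^ n * x ^ (n + 1)) := by
    refine (hquasi.summable_pow_mul_mul_pow (q * x) x).congr fun n => ?_
    have h1 : ∀ n : ℕ, q * (-(p * b * e)) ^ n = q * (-(p * b)) ^ n := by
      intro n
      rw [← neg_mul, hE.neg_left.mul_pow, (hE.neg_left.pow_pow n n).eq, ← mul_assoc]
      congr 1
      induction n with
      | zero => simp
      | succ n ih => rw [pow_succ', ← mul_assoc, hqe, ih]
    have h2 : Commute q (-(p * b * e)) := by
      exact (hqb.symm.mul_right hqE).neg_right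
    rw [← mul_assoc, ← (h2.pow_right n).eq, h1, pow_succ']
    simp only [mul_assoc]
  refine ⟨hsum, ?_⟩
  have hrec := hsum.tsum_eq_zero_add
  set S := ∑' n : ℕ, q * (-(p * b)) ^ n * x ^ (n + 1) with hS
  have hrec' : S = q * x + -(p * b) * S * x := by
    conv_lhs => rw [hrec]
    rw [hS, ← hsum.tsum_mul_left, ← (hsum.mul_left _).tsum_mul_right]
    simp only [pow_zero, mul_one, zero_add, pow_one]
    congr 1
    refine tsum_congr fun n => ?_
    have h1 : -(p * b) * q = q * -(p * b) := hqb.neg_left.eq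
    rw [← mul_assoc, ← mul_assoc, h1, pow_succ' (-(p * b)), pow_succ x (n + 1)]
    simp only [mul_assoc]
  have hcomm : ∀ y : A, Commute y q → Commute y (p * b) → Commute y x → Commute y S :=
    fun y h1 h2 h3 => Commute.tsum_right y fun n =>
      (h1.mul_right (h2.neg_right.pow_right n)).mul_right (h3.pow_right _)
  have hSa : a * S = S * a := hcomm a hqa h hax
  have hSb : p * b * S = S * (p * b) := hcomm (p * b) hqb (.refl _) hxb.symm
  have hSp : p * S = S * p := hcomm p hqP hpb' hxp.symm
  have hSq : q * S = S * q := hcomm q (.refl _) hqb.symm hqx.symm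
  have hqS : q * S = S := by
    rw [hS, ← hsum.tsum_mul_left]
    refine tsum_congr fun n => ?_
    rw [← mul_assoc, ← mul_assoc, hqq]
  have hpS : p * S = S := by
    rw [← hqS, ← mul_assoc, hqp]
  have hcS : (a * p + p * b) * S = q := by
    have hxa : x * a = p := hax.eq.symm
    linear_combination (norm := noncomm_ring) a * hpS + hSa + hrec' * a + q * hxa
      - p * b * S * hxa - hqP.eq + hqp + p * b * hSp - p * b * hpS
  have hSc : S * (a * p + p * b) = (a * p + p * b) * S := by
    linear_combination (norm := noncomm_ring) - hSa * p - a * hSp - hSb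
  -- Both S and w q invert c q, the latter by the product rule with the commuting idempotent q;
  -- uniqueness identifies them.
  have hSG : IsGDrazinInverse ((a * p + p * b) * q) S := by
    refine ⟨?_, ?_, ?_⟩
    · linear_combination (norm := noncomm_ring) S * (a * p + p * b) * hqS + S * hcS - hSq + hqS
    · linear_combination (norm := noncomm_ring)
        (a * p + p * b) * hqS + hcS - hSc * q - hcS * q - hqq
    · convert IsQuasinilpotent.zero (A := A) using 1
      linear_combination (norm := noncomm_ring) - (a * p + p * b) * q * (a * p + p * b) * hqS
        - (a * p + p * b) * q * hcS - (a * p + p * b) * hqq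
  rw [hceq] at hc
  exact (hc.mul (of_isIdempotentElem hqq) hqc).unique hSG

end IsGDrazinInverse
end Corners

/-! ### Expansion of the triangular formula and the main theorem. -/

section Main

variable {A : Type*} [NormedRing A] [NormedAlgebra ℂ A] [CompleteSpace A]

namespace IsGDrazinInverse

/-- This is `triangular` for s = a + b with Y expanded. Powers of Y collapse through Y^(m+1) = (z
r)^m Y, r = 1 - a x, and r a w = 0 allows a + b to be replaced by b in r (a + b) w. -/
theorem add_eq_series {a x b z w : A} (ha : IsGDrazinInverse a x)
    (hb : IsGDrazinInverse (b * (1 - a * x)) (z * (1 - a * x)))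
    (hpb : a * x * b * (1 - a * x) = 0) (hpz : a * x * z * (1 - a * x) = 0)
    (h : a * (1 - a * x) * (b * (1 - a * x)) =
      (1 - b * (1 - a * x) * (z * (1 - a * x))) * (b * (1 - a * x)) *
      (a * (1 - a * x)) * (1 - b * (1 - a * x) * (z * (1 - a * x))))
    (hc : IsGDrazinInverse (a * x * (a + b)) w) :
    Summable (fun n : ℕ => z ^ (n + 1) * a ^ n * (1 - a * x)) ∧
    Summable (fun n : ℕ => z ^ (n + 1) * a ^ n * (1 - a * x) * b * w) ∧
    (∀ n : ℕ, Summable (fun k : ℕ => z ^ (n + k + 2) * a ^ k * (1 - a * x) * b * a * x *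
      (a * x * (a + b)) ^ n * (1 - a * x * (a + b) * w))) ∧
    Summable (fun n : ℕ => ∑' k : ℕ, z ^ (n + k + 2) * a ^ k * (1 - a * x) * b * a * x *
      (a * x * (a + b)) ^ n * (1 - a * x * (a + b) * w)) ∧
    Summable (fun n : ℕ => (1 - b * z) * (a + b) ^ n * (1 - a * x) * b * w ^ (n + 2)) ∧
    (∀ n : ℕ, Summable (fun k : ℕ =>
      z ^ (k + 1) * a ^ (k + 1) * (a + b) ^ n * (1 - a * x) * b * w ^ (n + 2))) ∧
    Summable (fun n : ℕ => ∑' k : ℕ,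
      z ^ (k + 1) * a ^ (k + 1) * (a + b) ^ n * (1 - a * x) * b * w ^ (n + 2)) ∧
    IsGDrazinInverse (a + b) (w
      + (∑' n : ℕ, z ^ (n + 1) * a ^ n * (1 - a * x))
      - (∑' n : ℕ, z ^ (n + 1) * a ^ n * (1 - a * x) * b * w)
      + (∑' n : ℕ, ∑' k : ℕ, z ^ (n + k + 2) * a ^ k * (1 - a * x) * b * a * x *
          (a * x * (a + b)) ^ n * (1 - a * x * (a + b) * w))
      + (∑' n : ℕ, (1 - b * z) * (a + b) ^ n * (1 - a * x) * b * w ^ (n + 2))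
      - (∑' n : ℕ, ∑' k : ℕ,
          z ^ (k + 1) * a ^ (k + 1) * (a + b) ^ n * (1 - a * x) * b * w ^ (n + 2))) := by
  have hp := ha.isIdempotentElem_mul
  have hrr : (1 - a * x) * (1 - a * x) = 1 - a * x := ha.one_sub_mul_one_sub
  have hra : (1 - a * x) * a = a * (1 - a * x) := ha.mul_one_sub.symm
  have hzr : (1 - a * x) * z * (1 - a * x) = z * (1 - a * x) := by
    linear_combination (norm := noncomm_ring) - hpz
  have hps : a * x * (a + b) * (1 - a * x) = 0 := by
    linear_combination (norm := noncomm_ring) hpb - ha.one_sub_mul_mul_one_sub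
  obtain ⟨hsum, hd, hYb, hYpow⟩ :=
    add_quasinilpotent ha.isQuasinilpotent_mul_one_sub hb h
  rw [← add_mul] at hd
  have hsr : (1 - a * x) * (a + b) * (1 - a * x) = (a + b) * (1 - a * x) := by
    linear_combination (norm := noncomm_ring) - hps
  have hasr : ∀ n : ℕ, (a + b) ^ n * (1 - a * x) =
      (1 - a * x) * ((a + b) * (1 - a * x)) ^ n * (1 - a * x) := by
    intro n
    induction n with
    | zero => simp only [pow_zero, one_mul, mul_one, hrr]
    | succ n ih =>
      rw [pow_succ', mul_assoc, ih, pow_succ' ((a + b) * _), ← mul_assoc (1 - a * x) (_ * _),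
        ← mul_assoc _ (a + b), hsr]
      simp only [mul_assoc]
  have hPr : ∀ n : ℕ, ((a + b) * (1 - a * x)) ^ n * (1 - a * x) =
      (1 - a * x) * ((a + b) * (1 - a * x)) ^ n * (1 - a * x) := by
    intro n
    cases n with
    | zero => simp only [pow_zero, one_mul, mul_one, hrr]
    | succ n => rw [pow_succ', ← mul_assoc (1 - a * x) (_ * _), ← mul_assoc _ (a + b), hsr]
  have hzpow : ∀ n : ℕ, z ^ n * (1 - a * x) = (1 - a * x) * (z * (1 - a * x)) ^ n := by
    intro n
    induction n with
    | zero => simp only [pow_zero, one_mul, mul_one]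
    | succ n ih =>
      rw [pow_succ', mul_assoc, ih, pow_succ', ← mul_assoc, ← mul_assoc, ← mul_assoc, hzr]
  have hapow : ∀ n : ℕ, (1 - a * x) * (a * (1 - a * x)) ^ n = a ^ n * (1 - a * x) := by
    intro n
    induction n with
    | zero => simp only [pow_zero, one_mul, mul_one]
    | succ n ih =>
      rw [pow_succ, ← mul_assoc, ih, pow_succ, mul_assoc, ← mul_assoc (1 - a * x),
        ha.one_sub_mul_mul_one_sub, mul_assoc]
  have hza : ∀ m n : ℕ, z ^ (m + 1) * a ^ n * (1 - a * x) =
      (z * (1 - a * x)) ^ (m + 1) * (a * (1 - a * x)) ^ n := by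
    intro m n
    rw [mul_assoc, ← hapow, ← mul_assoc, hzpow, pow_succ', ← mul_assoc, ← mul_assoc, hzr]
  set Y := ∑' n : ℕ, (z * (1 - a * x)) ^ (n + 1) * (a * (1 - a * x)) ^ n with hY
  obtain ⟨hF, hG, hz⟩ := triangular hp hps hc hd
  have hYr : Y * (1 - a * x) = Y := by
    linear_combination (norm := noncomm_ring) - hd.mul_mul_self * (1 - a * x)
      + Y * Y * (a + b) * hrr + hd.mul_mul_self
  have hwp : a * x * w = w := by
    linear_combination (norm := noncomm_ring) - a * x * hc.self_mul_mul
      + hp.eq * (a + b) * w * w + hc.self_mul_mul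
  have hrap : (1 - a * x) * a * (a * x) = 0 := by
    linear_combination (norm := noncomm_ring) hra * a * x - a * hrr
  have hraw : (1 - a * x) * a * w = 0 := by
    linear_combination (norm := noncomm_ring) - (1 - a * x) * a * hwp + hrap * w
  have hraw' : ∀ n : ℕ, (1 - a * x) * a * w ^ (n + 2) = 0 := by
    intro n
    rw [pow_succ', ← mul_assoc, hraw, zero_mul]
  -- the six series
  have h1 : ∀ n : ℕ, z ^ (n + 1) * a ^ n * (1 - a * x) =
    (z * (1 - a * x)) ^ (n + 1) * (a * (1 - a * x)) ^ n := fun n => hza n n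
  have hs1 : Summable (fun n : ℕ => z ^ (n + 1) * a ^ n * (1 - a * x)) := by
    simpa only [h1] using hsum
  have ht1 : ∑' n : ℕ, z ^ (n + 1) * a ^ n * (1 - a * x) = Y := tsum_congr h1
  have h3 : ∀ n k : ℕ, z ^ (n + k + 2) * a ^ k * (1 - a * x) * b * a * x *
      (a * x * (a + b)) ^ n * (1 - a * x * (a + b) * w) =
      (z * (1 - a * x)) ^ (n + 1) * ((z * (1 - a * x)) ^ (k + 1) * (a * (1 - a * x)) ^ k) *
      (b * a * x * (a * x * (a + b)) ^ n * (1 - a * x * (a + b) * w)) := by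
    intro n k
    rw [hza (n + k + 1) k, ← mul_assoc (_ ^ (n + 1)), ← pow_add,
      show n + k + 1 + 1 = n + 1 + (k + 1) by ring]
    simp only [mul_assoc]
  have hs3 : ∀ n, Summable (fun k : ℕ => z ^ (n + k + 2) * a ^ k * (1 - a * x) * b * a * x *
      (a * x * (a + b)) ^ n * (1 - a * x * (a + b) * w)) := by
    intro n
    simp only [h3]
    exact (hsum.mul_left _).mul_right _
  have ht3 : ∀ n, ∑' k : ℕ, z ^ (n + k + 2) * a ^ k * (1 - a * x) * b * a * x *
      (a * x * (a + b)) ^ n * (1 - a * x * (a + b) * w) =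
      Y ^ (n + 2) * (1 - a * x) * (a + b) * (a * x) * (a * x * (a + b)) ^ n *
        (1 - a * x * (a + b) * w) := by
    intro n
    simp only [h3]
    rw [(hsum.mul_left _).tsum_mul_right, hsum.tsum_mul_left, ← hY, ← hYpow, show Y ^ (n + 2) = Y ^ (n + 1) * Y from pow_succ _ _]
    linear_combination (norm := noncomm_ring)
      - Y ^ (n + 1) * hYr * b * a * x * (a * x * (a + b)) ^ n * (1 - a * x * (a + b) * w)
      - Y ^ (n + 1) * Y * hrap * (a * x * (a + b)) ^ n * (1 - a * x * (a + b) * w)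
  have h6 : ∀ n k : ℕ, z ^ (k + 1) * a ^ (k + 1) * (a + b) ^ n * (1 - a * x) * b * w ^ (n + 2) =
      (z * (1 - a * x)) ^ (k + 1) * (a * (1 - a * x)) ^ k *
      (a * (1 - a * x) * ((a + b) * (1 - a * x)) ^ n * (1 - a * x) * b * w ^ (n + 2)) := by
    intro n k
    rw [mul_assoc _ ((a + b) ^ n), hasr, ← mul_assoc, ← mul_assoc, hza, pow_succ (a * (1 - a * x))]
    simp only [mul_assoc]
  have hs6 : ∀ n, Summable (fun k : ℕ =>
      z ^ (k + 1) * a ^ (k + 1) * (a + b) ^ n * (1 - a * x) * b * w ^ (n + 2)) := by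
    intro n
    simp only [h6]
    exact hsum.mul_right _
  have hQY : (1 - b * (1 - a * x) * (z * (1 - a * x))) * Y = 0 := by
    have hYY := hYpow 1
    rw [pow_one, one_add_one_eq_two, pow_two] at hYY
    linear_combination (norm := noncomm_ring)
      - (1 - b * (1 - a * x) * (z * (1 - a * x))) * hd.mul_mul_self
      + (1 - b * (1 - a * x) * (z * (1 - a * x))) * hYY * (a + b) * (1 - a * x)
      - hb.self_mul_mul * Y * (a + b) * (1 - a * x)
  -- This splits one series of `triangular` into the fifth minus the sixth series.
  have hdY : 1 - (a + b) * (1 - a * x) * Y =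
      1 - b * (1 - a * x) * (z * (1 - a * x)) - Y * (a * (1 - a * x)) := by
    linear_combination (norm := noncomm_ring) - hd.comm - hYb
  have h5' : ∀ n : ℕ, (1 - b * z) * (a + b) ^ n * (1 - a * x) * b * w ^ (n + 2) =
      (1 - b * (1 - a * x) * (z * (1 - a * x))) * ((a + b) * (1 - a * x)) ^ n * (1 - a * x) * b *
        w ^ (n + 2) := by
    intro n
    have e1 : (1 - b * z) * (1 - a * x) =
        (1 - b * (1 - a * x) * (z * (1 - a * x))) * (1 - a * x) := by
      linear_combination (norm := noncomm_ring) b * hzr * (1 - a * x) + b * z * hrr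
    have hPr' := hPr n
    rw [mul_assoc _ (_ ^ n), hasr]
    generalize 1 - b * (1 - a * x) * (z * (1 - a * x)) = Q at *
    generalize ((a + b) * (1 - a * x)) ^ n = P at *
    generalize w ^ (n + 2) = W
    generalize 1 - a * x = r at *
    linear_combination (norm := noncomm_ring) e1 * P * r * b * W - Q * hPr' * b * W
  -- Left multiplication by 1 - b r z r kills Y, so the fifth series is a multiple of an already
  -- summable one; the sixth is then summable as a difference.
  have h5 : ∀ n : ℕ, (1 - b * z) * (a + b) ^ n * (1 - a * x) * b * w ^ (n + 2) =
      (1 - b * (1 - a * x) * (z * (1 - a * x))) * ((1 - (a + b) * (1 - a * x) * Y) *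
        ((a + b) * (1 - a * x)) ^ n * (1 - a * x) * (a + b) * w ^ (n + 2)) := by
    intro n
    rw [h5']
    generalize 1 - b * (1 - a * x) * (z * (1 - a * x)) = Q at *
    have hd' := hd.comm
    have hw' := hraw' n
    generalize ((a + b) * (1 - a * x)) ^ n = P
    generalize w ^ (n + 2) = W at *
    generalize 1 - a * x = r at *
    linear_combination (norm := noncomm_ring) - Q * P * hw' + Q * hd' * P * r * (a + b) * W
      + hQY * (a + b) * r * P * r * (a + b) * W
  have hs5 : Summable (fun n : ℕ =>
      (1 - b * z) * (a + b) ^ n * (1 - a * x) * b * w ^ (n + 2)) := by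
    simp only [h5]
    exact hF.mul_left _
  have ht6 : ∀ n, ∑' k : ℕ,
      z ^ (k + 1) * a ^ (k + 1) * (a + b) ^ n * (1 - a * x) * b * w ^ (n + 2) =
      (1 - b * z) * (a + b) ^ n * (1 - a * x) * b * w ^ (n + 2) -
      (1 - (a + b) * (1 - a * x) * Y) * ((a + b) * (1 - a * x)) ^ n * (1 - a * x) * (a + b) *
        w ^ (n + 2) := by
    intro n
    simp only [h6]
    rw [hsum.tsum_mul_right, ← hY, h5', hdY]
    have hw' := hraw' n
    generalize 1 - b * (1 - a * x) * (z * (1 - a * x)) = Q at *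
    generalize ((a + b) * (1 - a * x)) ^ n = P
    generalize w ^ (n + 2) = W at *
    generalize 1 - a * x = r at *
    linear_combination (norm := noncomm_ring) (Q - Y * (a * r)) * P * hw'
  have hs6' : Summable (fun n : ℕ => ∑' k : ℕ,
      z ^ (k + 1) * a ^ (k + 1) * (a + b) ^ n * (1 - a * x) * b * w ^ (n + 2)) := by
    simp only [ht6]
    exact hs5.sub hF
  have hs1' : Summable (fun n : ℕ => z ^ (n + 1) * a ^ n * (1 - a * x) * b * w) :=
    (hs1.mul_right b).mul_right w
  refine ⟨hs1, hs1', hs3, ?_, hs5, hs6, hs6', ?_⟩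
  · simp only [ht3]
    exact hG
  · convert hz using 1
    rw [(hs1.mul_right b).tsum_mul_right, hs1.tsum_mul_right, ht1, tsum_congr ht3, tsum_congr ht6,
      hs5.tsum_sub hF]
    have h2 : Y * b * w = Y * (a + b) * w := by
      linear_combination (norm := noncomm_ring) hYr * a * w - Y * hraw
    rw [h2]
    abel

end IsGDrazinInverse
end Main

theorem theorem2p2 {A : Type*} [NormedRing A] [NormedAlgebra ℂ A] [CompleteSpace A]
    (a b : A) (ha : IsGDrazinInvertible a) (hb : IsGDrazinInvertible b)
    (hab : a * b * aᵖ = aᵖ * bᵖ * b * a * bᵖ * aᵖ)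
    (hcomm : a ^ 2 * aᵈ * b = a * aᵈ * b * a)
    (hcorner : IsGDrazinInvertible (aᵖ * b * aᵖ) ∨ IsGDrazinInvertible (aᵖ * b) ∨
      IsGDrazinInvertible (b * aᵖ) ∨ IsGDrazinInvertible (a * aᵈ * b * (a * aᵈ)) ∨
      IsGDrazinInvertible (a * aᵈ * b) ∨ IsGDrazinInvertible (b * (a * aᵈ))) :
    [IsGDrazinInvertible (a + b),
      IsGDrazinInvertible (1 + aᵈ * b),
      IsGDrazinInvertible (a * aᵈ * (1 + aᵈ * b)),
      IsGDrazinInvertible ((1 + aᵈ * b) * (a * aᵈ)),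
      IsGDrazinInvertible (a * aᵈ * (1 + aᵈ * b) * (a * aᵈ))].TFAE ∧
    (IsGDrazinInvertible (a + b) →
      ∀ c : A, c = a * aᵈ * (a + b) →
        -- the generalized Drazin inverse of `c`
        IsGDrazinInvertible c ∧
        Summable (fun n : ℕ => a * aᵈ * bᵖ * (-b) ^ n * aᵈ ^ (n + 1)) ∧
        cᵈ = aᵈ * (1 + aᵈ * b)ᵈ * b * bᵈ
          + ∑' n : ℕ, a * aᵈ * bᵖ * (-b) ^ n * aᵈ ^ (n + 1) ∧
        -- convergence of the series in the formula for `(a + b)ᵈ`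
        Summable (fun n : ℕ => bᵈ ^ (n + 1) * a ^ n * aᵖ) ∧
        Summable (fun n : ℕ => bᵈ ^ (n + 1) * a ^ n * aᵖ * b * cᵈ) ∧
        (∀ n : ℕ, Summable (fun k : ℕ =>
          bᵈ ^ (n + k + 2) * a ^ k * aᵖ * b * a * aᵈ * c ^ n * cᵖ)) ∧
        Summable (fun n : ℕ => ∑' k : ℕ,
          bᵈ ^ (n + k + 2) * a ^ k * aᵖ * b * a * aᵈ * c ^ n * cᵖ) ∧
        Summable (fun n : ℕ => bᵖ * (a + b) ^ n * aᵖ * b * cᵈ ^ (n + 2)) ∧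
        (∀ n : ℕ, Summable (fun k : ℕ =>
          bᵈ ^ (k + 1) * a ^ (k + 1) * (a + b) ^ n * aᵖ * b * cᵈ ^ (n + 2))) ∧
        Summable (fun n : ℕ => ∑' k : ℕ,
          bᵈ ^ (k + 1) * a ^ (k + 1) * (a + b) ^ n * aᵖ * b * cᵈ ^ (n + 2)) ∧
        -- the formula for `(a + b)ᵈ`
        (a + b)ᵈ = cᵈ
          + (∑' n : ℕ, bᵈ ^ (n + 1) * a ^ n * aᵖ)
          - (∑' n : ℕ, bᵈ ^ (n + 1) * a ^ n * aᵖ * b * cᵈ)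
          + (∑' n : ℕ, ∑' k : ℕ,
              bᵈ ^ (n + k + 2) * a ^ k * aᵖ * b * a * aᵈ * c ^ n * cᵖ)
          + (∑' n : ℕ, bᵖ * (a + b) ^ n * aᵖ * b * cᵈ ^ (n + 2))
          - (∑' n : ℕ, ∑' k : ℕ,
              bᵈ ^ (k + 1) * a ^ (k + 1) * (a + b) ^ n * aᵖ * b * cᵈ ^ (n + 2))) := by
  obtain ⟨z, hz⟩ := hb
  obtain ⟨x, hx⟩ := ha
  rw [hx.eq_gDrazinInv] at hcomm hcorner ⊢
  simp only [spectralIdem, hx.eq_gDrazinInv, hz.eq_gDrazinInv] at hab hcorner ⊢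
  have hp := hx.isIdempotentElem_mul
  have h : Commute a (a * x * b) := by
    show _ = _
    linear_combination (norm := noncomm_ring) hcomm
  have hpb : a * x * b * (1 - a * x) = 0 := hx.mul_mul_one_sub_eq_zero h
  have hpz := hz.corners_of_isGDrazinInvertible hp hpb hcorner
  obtain ⟨hb₁, hb₂⟩ := hz.corners hpb hpz
  have hpa : Commute a (a * x) := (Commute.refl a).mul_right hx.comm
  have hq := IsGDrazinInverse.mul_corner_eq hp hpa hpb hpz hab
  have hd : IsGDrazinInvertible ((a + b) * (1 - a * x)) := by
    have := (IsGDrazinInverse.add_quasinilpotent hx.isQuasinilpotent_mul_one_sub hb₂ hq).2.1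
    rw [← add_mul] at this
    exact ⟨_, this⟩
  have hps : a * x * (a + b) * (1 - a * x) = 0 := by
    linear_combination (norm := noncomm_ring) hpb - hx.one_sub_mul_mul_one_sub
  have hxc : Commute x (a * x * (a + b)) := by
    rw [mul_add]
    exact ((Commute.mul_right hx.comm.symm (Commute.refl x)).mul_right hx.comm.symm).add_right
      (hx.commute h)
  have hxb : x * b = x * (a * x * b) := by
    linear_combination (norm := noncomm_ring) - hx.outer * b
  have ha₁ : Commute a (1 + x * b) := by
    rw [hxb]
    exact (Commute.one_right a).add_right (Commute.mul_right hx.comm h)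
  have hx₁ : Commute x (1 + x * b) := by
    rw [hxb]
    exact (Commute.one_right x).add_right ((Commute.refl x).mul_right (hx.commute h))
  have hp₁ : Commute (a * x) (1 + x * b) := ha₁.mul_left hx₁
  have hcw : ∀ g : A, IsGDrazinInverse (1 + x * b) g →
      IsGDrazinInverse (a * x * (a + b)) (x * g) := by
    intro g hg
    convert hx.mul_mul_inverse.mul hg (ha₁.mul_left hp₁) using 1
    linear_combination (norm := noncomm_ring) - a * hx.comm - a * hx.self_mul_mul * b
  have hw : ∀ w : A, IsGDrazinInverse (a * x * (a + b)) w → IsGDrazinInvertible (1 + x * b) := by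
    intro w hw
    have h1 := (hx.inverse.mul hw hxc)
    have h2 := IsGDrazinInverse.of_isIdempotentElem hp.one_sub
    have h3 : x * (a * x * (a + b)) * (1 - a * x) = 0 := by
      linear_combination (norm := noncomm_ring) x * hps
    have h4 := (h1.add_of_mul_eq_zero h2 h3).2.2
    -- On p A p, 1 + x b acts as x c; the complementary idempotent supplies the rest.
    have h5 : x * (a * x * (a + b)) + (1 - a * x) = 1 + x * b := by
      linear_combination (norm := noncomm_ring) hx.outer * b + hx.outer * a - hx.comm
    rw [h5] at h4
    exact ⟨_, h4⟩
  have e₁ : (1 + x * b) * (a * x) = a * x * (1 + x * b) := hp₁.symm.eq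
  have e₂ : a * x * (1 + x * b) * (a * x) = a * x * (1 + x * b) := by
    rw [mul_assoc, e₁, ← mul_assoc, hp.eq]
  refine ⟨?_, ?_⟩
  · rw [e₂, e₁]
    tfae_have 1 → 2 := by
      rintro ⟨t, ht⟩
      obtain ⟨y, hy⟩ := hd
      -- The r-corner of a + b is always invertible in the generalized sense, so the inverse t is
      -- triangular and its p-corner inverts c.
      exact hw _ (ht.corners hps (ht.corner_eq_zero_right hp hps hy)).1
    tfae_have 2 → 3 := by
      rintro ⟨g, hg⟩
      exact ⟨_, (IsGDrazinInverse.of_isIdempotentElem hp).mul hg e₁.symm⟩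
    tfae_have 3 → 1 := by
      rintro ⟨g, hg⟩
      obtain ⟨y, hy⟩ := hd
      have h1 : Commute (a * (a * x)) (a * x * (1 + x * b)) :=
        (hpa.mul_left (Commute.refl (a * x))).mul_right (ha₁.mul_left hp₁)
      have h2 := hx.mul_mul_inverse.mul hg h1
      have h3 : a * (a * x) * (a * x * (1 + x * b)) = a * x * (a + b) := by
        linear_combination (norm := noncomm_ring) a * a * hx.outer * (1 + x * b) + a * hx.comm
          + a * hx.self_mul_mul * b
      rw [h3] at h2
      exact ⟨_, (IsGDrazinInverse.triangular hp hps h2 hy).2.2⟩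
    tfae_have 3 ↔ 4 := Iff.rfl
    tfae_have 3 ↔ 5 := Iff.rfl
    tfae_finish
  · rintro ⟨t, ht⟩ c rfl
    have hc : IsGDrazinInvertible (a * x * (a + b)) := by
      obtain ⟨y, hy⟩ := hd
      exact ⟨_, (ht.corners hps (ht.corner_eq_zero_right hp hps hy)).1⟩
    obtain ⟨w, hw'⟩ := hc
    obtain ⟨g, hg⟩ := hw w hw'
    have hxg : w = x * g := hw'.unique (hcw g hg)
    rw [hw'.eq_gDrazinInv, hg.eq_gDrazinInv]
    obtain ⟨hS, hSeq⟩ := hx.mul_one_sub_eq_tsum h hb₁ hpb hw'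
    obtain ⟨s₁, s₂, s₃, s₄, s₅, s₆, s₇, hinv⟩ := hx.add_eq_series hb₂ hpb hpz hq hw'
    refine ⟨⟨w, hw'⟩, hS, ?_, s₁, s₂, s₃, s₄, s₅, s₆, s₇, hinv.eq_gDrazinInv⟩
    -- What remains is w = w b z + w (1 - b z).
    rw [← hSeq, ← hxg]
    noncomm_ring
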